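/- **Hartogs' Theorem for real analytic mappings.** A *dual pair* $(E,E')$ is a real vector space $E$ together with a point separating linear subspace $E'$ of its algebraic dual. A set $B\subseteq E$ is *bounded* if $\lambda(B)$ is bounded in $\mathbb R$ for all $\lambda\in E'$. The dual pair is *complete* if every bounded set is contained in a bounded absolutely convex set $A$ for which the normed space $E_A$ (the linear span of $A$, normed by the Minkowski functional of $A$) is complete. A curve $c:\mathbb R\to E$ is *smooth* (respectively *real analytic*) if $\lambda\circ c:\mathbb R\to\mathbb R$ is smooth (respectively real analytic) for all $\lambda\in E'$. A set $U\subseteq E$ is *$c^\infty$-open* if $c^{-1}(U)$ is open in $\mathbb R$ for every smooth curve $c:\mathbb R\to E$. If $U\subseteq E$ is $c^\infty$-open and $(F,F')$ is a second dual pair, a map $f:U\to F$ is *smooth* if $f\circ c$ is a smooth curve in $F$ for every smooth curve $c:\mathbb R\to E$ with $c(\mathbb R)\subseteq U$; it is *real analytic* if it is smooth and $f\circ c$ is a real analytic curve in $F$ for every real analytic curve $c:\mathbb R\to E$ with $c(\mathbb R)\subseteq U$. Let $(E,E')$ and $(F,F')$ be complete dual pairs, let $U\subseteq E$ be $c^\infty$-open,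 and let $f:U\to F$ be a map. Then $f$ is real analytic if and only if $f$ is smooth and, for every $\lambda\in F'$, the function $\lambda\circ f$ is real analytic along each affine line in $E$; that is, for all $x,v\in E$ the function $t\mapsto\lambda(f(x+tv))$ is real analytic on the open set $\{t\in\mathbb R: x+tv\in U\}$. -/

import Mathlib

open Filter Topology
open scoped ContDiff

/-- A dual pair `(E, E')`: a real vector space `E` together with a prescribed point separating
linear subspace `E'` (the field `dual`) of the algebraic dual of `E`. -/
structure DualPair (E : Type*) [AddCommGroup E] [Module ℝ E] where
  dual : Submodule ℝ (Module.Dual ℝ E)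
  separating : ∀ x : E, (∀ l ∈ dual, l x = 0) → x = 0

namespace DualPair

variable {E F : Type*} [AddCommGroup E] [Module ℝ E] [AddCommGroup F] [Module ℝ F]

/-- A subset `B` of `E` is bounded if `l(B)` is bounded in `ℝ` for all `l ∈ E'`. -/
def IsBounded (P : DualPair E) (B : Set E) : Prop :=
  ∀ l ∈ P.dual, Bornology.IsBounded (l '' B)

/-- Completeness of the space `E_A` generated by `A`, that is, of the linear span of `A` with the
Minkowski functional (gauge) of `A` as its norm, expressed by Cauchy sequences. It is used only for
bounded absolutely convex `A`, for which the gauge is a norm on the span. -/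
def SpanComplete (A : Set E) : Prop :=
  ∀ u : ℕ → E, (∀ n, u n ∈ Submodule.span ℝ A) →
    (∀ ε > 0, ∃ N : ℕ, ∀ m ≥ N, ∀ n ≥ N, gauge A (u m - u n) < ε) →
    ∃ x ∈ Submodule.span ℝ A, Tendsto (fun n => gauge A (u n - x)) atTop (𝓝 0)

/-- The dual pair is complete if every bounded set `B` is contained in a bounded absolutely convex
set `A` such that the normed space `E_A` is complete. -/
def IsComplete (P : DualPair E) : Prop :=
  ∀ B : Set E, P.IsBounded B →
    ∃ A : Set E, B ⊆ A ∧ P.IsBounded A ∧ AbsConvex ℝ A ∧ SpanComplete A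

/-- A curve `c : ℝ → E` is smooth if `l ∘ c : ℝ → ℝ` is smooth for all `l ∈ E'`. -/
def SmoothCurve (P : DualPair E) (c : ℝ → E) : Prop :=
  ∀ l ∈ P.dual, ContDiff ℝ ∞ (fun t => l (c t))

/-- A curve `c : ℝ → E` is real analytic if `l ∘ c : ℝ → ℝ` is real analytic for all `l ∈ E'`. -/
def AnalyticCurve (P : DualPair E) (c : ℝ → E) : Prop :=
  ∀ l ∈ P.dual, AnalyticOnNhd ℝ (fun t => l (c t)) Set.univ

/-- `U ⊆ E` is `c^∞`-open if its inverse image under every smooth curve is open. -/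
def CInftyOpen (P : DualPair E) (U : Set E) : Prop :=
  ∀ c : ℝ → E, P.SmoothCurve c → IsOpen (c ⁻¹' U)

/-- `f : U → F` is smooth: it maps smooth curves in `U` to smooth curves. Here and below a map on
`U` is given by a function on `E`, of which only the values on `U` matter. -/
def SmoothOn (P : DualPair E) (Q : DualPair F) (f : E → F) (U : Set E) : Prop :=
  ∀ c : ℝ → E, P.SmoothCurve c → (∀ t, c t ∈ U) → Q.SmoothCurve (fun t => f (c t))

/-- `f : U → F` is real analytic: it is smooth and it maps real analytic curves in `U` to real
analytic curves. -/
def RealAnalyticOn (P : DualPair E) (Q : DualPair F) (f : E → F) (U : Set E) : Prop :=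
  P.SmoothOn Q f U ∧
    ∀ c : ℝ → E, P.AnalyticCurve c → (∀ t, c t ∈ U) → Q.AnalyticCurve (fun t => f (c t))

/-- `g : U → ℝ` is real analytic along each affine line `t ↦ x + t v` of `E`, that is,
`t ↦ g (x + t v)` is real analytic on the set (open, when `U` is `c^∞`-open) of all `t` with
`x + t v ∈ U`. The line need not be contained in `U`. -/
def AnalyticAlongLinesOn (g : E → ℝ) (U : Set E) : Prop :=
  ∀ x v : E, AnalyticOnNhd ℝ (fun t : ℝ => g (x + t • v)) {t : ℝ | x + t • v ∈ U}

end DualPair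

/-! Only analyticity of `g = l ∘ f ∘ c` at `0` along an analytic curve `c` is hard. The radius of
convergence of `l' ∘ c` may depend on the functional `l'`, so no geometric bound serves all
functionals at once. Any prescribed sequence `M n → ∞` does: the Taylor coefficients of `c` divided
by `M n ^ n`, with similarly scaled remainders, form a bounded set. By completeness this set comes
from the unit ball of a Banach space `X` mapping into `E`, so `c` lifts locally to a curve in `X`
with controlled Taylor expansions (`AnalyticCurve.exists_banach`).

On a ball of `X` the map `l ∘ f` is smooth along smooth curves and analytic along lines, and
Hartogs' theorem for Banach spaces (`analyticAt_of_smooth_of_analyticAlongLines`) makes it analytic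
at `0`. For this, the directional Taylor coefficients are homogeneous, locally bounded by the
special curve lemma, and annihilated by differences of order one more than their degree; hence they
are diagonals of continuous multilinear forms. Baire's theorem bounds all of them on one ball, and
because mixed differences do not depend on the base point, this bounds the forms themselves. The
resulting power series equals the function by the identity theorem on lines.

Composing the series with Taylor polynomials of the lifted curve bounds `iteratedDeriv n g` near `0`
by `K * (C * M n) ^ n * n!`. Were `g` not analytic, its normalized derivatives would outgrow every
geometric sequence along some orders `L j`; choosing `M` with `M (L j) = j + 1` gives a
contradiction.

The converse uses an analytic reparametrization of a short open segment by the whole real line. -/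

/-! ### One-variable Taylor estimates and a criterion for analyticity. -/

/-- Taylor's formula with the Lagrange estimate of the remainder, in terms of `iteratedDeriv`. -/
theorem abs_sub_taylor_le {g : ℝ → ℝ} {n : ℕ} {x₀ x C : ℝ}
    (hg : ∀ t ∈ Set.uIcc x₀ x, ContDiffAt ℝ (n + 1) g t)
    (hC : ∀ t ∈ Set.uIcc x₀ x, |iteratedDeriv (n + 1) g t| ≤ C) :
    |g x - ∑ k ∈ Finset.range (n + 1), iteratedDeriv k g x₀ / k.factorial * (x - x₀) ^ k| ≤
      C * |x - x₀| ^ (n + 1) / (n + 1).factorial := by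
  have hsum : x₀ ≠ x → taylorWithinEval g n (Set.uIcc x₀ x) x₀ x =
      ∑ k ∈ Finset.range (n + 1), iteratedDeriv k g x₀ / k.factorial * (x - x₀) ^ k := by
    intro hx
    rw [taylor_within_apply]
    refine Finset.sum_congr rfl fun k hk => ?_
    rw [iteratedDerivWithin_eq_iteratedDeriv (uniqueDiffOn_uIcc hx) _ Set.left_mem_uIcc,
      smul_eq_mul]
    · ring
    · refine (hg x₀ Set.left_mem_uIcc).of_le ?_
      have : k ≤ n + 1 := by have := Finset.mem_range.1 hk; omega
      exact_mod_cast this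
  rcases eq_or_ne x₀ x with rfl | hx
  · have : ∑ k ∈ Finset.range (n + 1), iteratedDeriv k g x₀ / k.factorial * (x₀ - x₀) ^ k = g x₀ := by
      rw [Finset.sum_range_succ']
      simp
    rw [this]
    simp
  · obtain ⟨y, hy, h⟩ := taylor_mean_remainder_lagrange_iteratedDeriv (f := g) (n := n) hx
      (fun t ht => (hg t ht).contDiffWithinAt)
    rw [← hsum hx, h, abs_div, abs_mul, abs_pow, Nat.abs_cast]
    have := hC y (Set.Ioo_subset_Icc_self hy)
    gcongr

theorem continuousAt_iteratedDeriv_of_contDiffAt {g : ℝ → ℝ} {n : ℕ} {x : ℝ}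
    (hg : ContDiffAt ℝ n g x) : ContinuousAt (iteratedDeriv n g) x := by
  have h : iteratedDeriv n g = fun t => iteratedFDeriv ℝ n g t fun _ => 1 := by
    ext t; exact iteratedDeriv_eq_iteratedFDeriv
  rw [h]
  have := (hg.iteratedFDeriv_right (m := 0) (i := n) (by simp)).continuousAt
  exact (ContinuousMultilinearMap.apply ℝ (fun _ : Fin n => ℝ) ℝ
    (fun _ => 1)).continuous.continuousAt.comp this

theorem isBigO_sub_taylor {g : ℝ → ℝ} {n : ℕ} {x₀ : ℝ} (hg : ContDiffAt ℝ (n + 1) g x₀) :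
    (fun x => g x - ∑ k ∈ Finset.range (n + 1), iteratedDeriv k g x₀ / k.factorial * (x - x₀) ^ k)
      =O[𝓝 x₀] fun x => (x - x₀) ^ (n + 1) := by
  have h1 : ∀ᶠ t in 𝓝 x₀, ContDiffAt ℝ (n + 1) g t := hg.eventually (by
    exact ne_of_lt (by exact_mod_cast ENat.natCast_lt_top (n + 1)))
  have h2 : ∀ᶠ t in 𝓝 x₀, |iteratedDeriv (n + 1) g t| < |iteratedDeriv (n + 1) g x₀| + 1 :=
    (continuousAt_iteratedDeriv_of_contDiffAt (n := n + 1)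
      (by exact_mod_cast hg)).abs.eventually_lt_const (lt_add_one _)
  obtain ⟨δ, hδ, h⟩ := Metric.eventually_nhds_iff_ball.1 (h1.and h2)
  refine Asymptotics.IsBigO.of_bound
    ((|iteratedDeriv (n + 1) g x₀| + 1) / (n + 1).factorial) ?_
  filter_upwards [Metric.ball_mem_nhds x₀ hδ] with x hx
  have hsub : Set.uIcc x₀ x ⊆ Metric.ball x₀ δ := by
    rw [← segment_eq_uIcc]
    exact (convex_ball x₀ δ).segment_subset (Metric.mem_ball_self hδ) hx
  have := abs_sub_taylor_le (fun t ht => (h t (hsub ht)).1) (fun t ht => (h t (hsub ht)).2.le)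
  rw [Real.norm_eq_abs, Real.norm_eq_abs, abs_pow]
  exact this.trans_eq (by ring)

/-- Once the Taylor coefficients below `j` vanish, the `j`-th Taylor monomial is itself `O((x - x₀)
^ (j + 1))`; dividing by `(x - x₀) ^ j` and letting `x → x₀` kills its coefficient. -/
theorem iteratedDeriv_eq_zero_of_isBigO {g : ℝ → ℝ} {n : ℕ} {x₀ : ℝ}
    (hg : ContDiffAt ℝ (n + 1) g x₀) (h : g =O[𝓝 x₀] fun x => (x - x₀) ^ (n + 1)) :
    ∀ j ≤ n, iteratedDeriv j g x₀ = 0 := by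
  intro j
  induction j using Nat.strong_induction_on with
  | _ j ih =>
    intro hj
    have h1 := isBigO_sub_taylor (n := j) (hg.of_le (by exact_mod_cast Nat.succ_le_succ hj))
    have h2 : g =O[𝓝 x₀] fun x => (x - x₀) ^ (j + 1) := by
      refine h.trans (Asymptotics.IsBigO.of_bound 1 ?_)
      filter_upwards [Metric.ball_mem_nhds x₀ one_pos] with x hx
      rw [norm_pow, norm_pow, one_mul]
      refine pow_le_pow_of_le_one (norm_nonneg _) ?_ (by omega)
      rw [← dist_eq_norm]
      exact (Metric.mem_ball.1 hx).le
    have h3 := h2.sub h1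
    have h4 : (fun x => g x - (g x - ∑ k ∈ Finset.range (j + 1),
        iteratedDeriv k g x₀ / k.factorial * (x - x₀) ^ k)) =
        fun x => iteratedDeriv j g x₀ / j.factorial * (x - x₀) ^ j := by
      ext x
      rw [sub_sub_cancel, Finset.sum_range_succ, Finset.sum_eq_zero, zero_add]
      intro k hk
      have hk := Finset.mem_range.1 hk
      rw [ih k hk (by omega)]
      simp
    rw [h4] at h3
    have h5 : (fun _ : ℝ => iteratedDeriv j g x₀ / j.factorial) =O[𝓝[≠] x₀] fun x => x - x₀ := by
      obtain ⟨C, hC⟩ := (h3.mono nhdsWithin_le_nhds : _ =O[𝓝[≠] x₀] _).bound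
      refine Asymptotics.IsBigO.of_bound C ?_
      filter_upwards [hC, self_mem_nhdsWithin] with x hx hne
      have hpos : 0 < ‖x - x₀‖ ^ j := pow_pos (norm_pos_iff.2 (sub_ne_zero.2 hne)) _
      rw [norm_mul, norm_pow, norm_pow, pow_succ', ← mul_assoc] at hx
      exact le_of_mul_le_mul_right hx hpos
    have h6 : Tendsto (fun x : ℝ => x - x₀) (𝓝[≠] x₀) (𝓝 0) := by
      have : Tendsto (fun x : ℝ => x - x₀) (𝓝 x₀) (𝓝 (x₀ - x₀)) := by
        exact (continuous_id.sub continuous_const).tendsto x₀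
      rw [sub_self] at this
      exact this.mono_left nhdsWithin_le_nhds
    have h7 := tendsto_nhds_unique (h5.trans_tendsto h6) tendsto_const_nhds
    have : (j.factorial : ℝ) ≠ 0 := by positivity
    have h8 := h7.symm
    rw [div_eq_zero_iff] at h8
    exact h8.resolve_right this

/-- Geometric bounds for the normalized derivatives on a neighborhood imply analyticity. -/
theorem analyticAt_of_iteratedDeriv_bound {g : ℝ → ℝ} {x₀ δ K C : ℝ} (hδ : 0 < δ)
    (hg : ∀ t ∈ Metric.ball x₀ δ, ContDiffAt ℝ ∞ g t)
    (hb : ∀ t ∈ Metric.ball x₀ δ, ∀ n : ℕ, |iteratedDeriv n g t| ≤ K * C ^ n * n.factorial) :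
    AnalyticAt ℝ g x₀ := by
  refine ⟨FormalMultilinearSeries.ofScalars ℝ (fun n => iteratedDeriv n g x₀ / n.factorial), ?_⟩
  rw [hasFPowerSeriesAt_iff]
  have hlim : ∀ᶠ z : ℝ in 𝓝 0, |C| * |z| < 1 := by
    have : Tendsto (fun z : ℝ => |C| * |z|) (𝓝 0) (𝓝 (|C| * |0|)) :=
      (continuous_const.mul continuous_abs).tendsto 0
    simp only [abs_zero, mul_zero] at this
    exact this.eventually_lt_const one_pos
  filter_upwards [Metric.ball_mem_nhds (0 : ℝ) hδ, hlim] with z hz hCz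
  simp only [FormalMultilinearSeries.coeff_ofScalars, smul_eq_mul]
  have hball : ∀ t ∈ Set.uIcc x₀ (x₀ + z), t ∈ Metric.ball x₀ δ := by
    intro t ht
    rw [← segment_eq_uIcc] at ht
    refine (convex_ball x₀ δ).segment_subset (Metric.mem_ball_self hδ) ?_ ht
    simpa [Metric.mem_ball, Real.dist_eq] using hz
  have hK : ∀ n : ℕ, K * C ^ n ≤ |K| * |C| ^ n := fun n => by
    rw [← abs_pow, ← abs_mul]; exact le_abs_self _
  have hgeo : Summable fun n : ℕ => |K| * (|C| * |z|) ^ n :=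
    (summable_geometric_of_lt_one (by positivity) hCz).mul_left _
  have hsum : Summable fun n : ℕ => z ^ n * (iteratedDeriv n g x₀ / n.factorial) := by
    refine Summable.of_norm_bounded hgeo fun n => ?_
    have hb' := (hb x₀ (Metric.mem_ball_self hδ) n).trans
      (mul_le_mul_of_nonneg_right (hK n) (by positivity))
    rw [Real.norm_eq_abs, abs_mul, abs_div, Nat.abs_cast, abs_pow, mul_pow]
    have : |iteratedDeriv n g x₀| / n.factorial ≤ |K| * |C| ^ n := by
      rw [div_le_iff₀ (by positivity)]; exact hb'
    calc |z| ^ n * (|iteratedDeriv n g x₀| / n.factorial) ≤ |z| ^ n * (|K| * |C| ^ n) := by gcongr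
      _ = _ := by ring
  rw [hsum.hasSum_iff_tendsto_nat, ← tendsto_add_atTop_iff_nat 1]
  rw [tendsto_iff_norm_sub_tendsto_zero]
  have hz0 : Tendsto (fun n : ℕ => |K| * (|C| * |z|) ^ (n + 1)) atTop (𝓝 0) :=
    (tendsto_add_atTop_iff_nat 1).2 hgeo.tendsto_atTop_zero
  refine squeeze_zero (fun _ => norm_nonneg _) (fun n => ?_) hz0
  have := abs_sub_taylor_le (n := n) (x₀ := x₀) (x := x₀ + z) (g := g)
    (C := |K| * |C| ^ (n + 1) * (n + 1).factorial)
    (fun t ht => (hg t (hball t ht)).of_le (by exact_mod_cast le_top))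
    (fun t ht => (hb t (hball t ht) (n + 1)).trans
      (mul_le_mul_of_nonneg_right (hK (n + 1)) (by positivity)))
  rw [norm_sub_rev, Real.norm_eq_abs]
  rw [add_sub_cancel_left] at this
  have h2 : |K| * |C| ^ (n + 1) * (n + 1).factorial * |z| ^ (n + 1) / (n + 1).factorial =
      |K| * (|C| * |z|) ^ (n + 1) := by
    have : ((n + 1).factorial : ℝ) ≠ 0 := by positivity
    rw [mul_pow]; field_simp
  rw [h2] at this
  refine le_trans (le_of_eq ?_) this
  congr 2
  exact Finset.sum_congr rfl fun k _ => by ring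

/-! ### Mixed differences. -/

section MixedDifferences

variable {ι X : Type*} [AddCommGroup X]

/-- The (signed) mixed difference `∑_{S ⊆ s} (-1)^|S| φ (x + ∑_{i ∈ S} h i)`. -/
def mixedDiff (s : Finset ι) (h : ι → X) (φ : X → ℝ) (x : X) : ℝ :=
  ∑ S ∈ s.powerset, (-1) ^ S.card * φ (x + ∑ i ∈ S, h i)

theorem mixedDiff_insert [DecidableEq ι] {s : Finset ι} {i : ι} (hi : i ∉ s) (h : ι → X) (φ : X → ℝ)
    (x : X) : mixedDiff (insert i s) h φ x = mixedDiff s h φ x - mixedDiff s h φ (x + h i) := by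
  unfold mixedDiff
  rw [Finset.sum_powerset_insert hi, sub_eq_add_neg, ← Finset.sum_neg_distrib]
  congr 1
  refine Finset.sum_congr rfl fun S hS => ?_
  have hiS : i ∉ S := fun h' => hi (Finset.mem_powerset.1 hS h')
  rw [Finset.card_insert_of_notMem hiS, Finset.sum_insert hiS, pow_succ, add_assoc]
  ring

theorem mixedDiff_congr {s : Finset ι} {h h' : ι → X} (hh : ∀ i ∈ s, h i = h' i) (φ : X → ℝ)
    (x : X) : mixedDiff s h φ x = mixedDiff s h' φ x := by
  unfold mixedDiff
  refine Finset.sum_congr rfl fun S hS => ?_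
  rw [Finset.sum_congr rfl fun i hi => hh i (Finset.mem_powerset.1 hS hi)]

theorem mixedDiff_eq_zero_of_eq_zero {s : Finset ι} {i : ι} (hi : i ∈ s) {h : ι → X} (h0 : h i = 0)
    (φ : X → ℝ) (x : X) : mixedDiff s h φ x = 0 := by
  classical
  rw [← Finset.insert_erase hi, mixedDiff_insert (Finset.notMem_erase i s), h0, add_zero, sub_self]

theorem mixedDiff_map {κ : Type*} (e : κ ↪ ι) (s : Finset κ) (h : ι → X) (φ : X → ℝ) (x : X) :
    mixedDiff (s.map e) h φ x = mixedDiff s (fun k => h (e k)) φ x := by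
  classical
  induction s using Finset.induction_on generalizing x with
  | empty => simp [mixedDiff]
  | insert i s hi ih =>
    rw [Finset.map_insert, mixedDiff_insert (by simpa using hi), mixedDiff_insert hi, ih, ih]

theorem mixedDiff_univ_succ {n : ℕ} (h : Fin (n + 1) → X) (φ : X → ℝ) (x : X) :
    mixedDiff Finset.univ h φ x = mixedDiff Finset.univ (fun i : Fin n => h i.succ) φ x -
      mixedDiff Finset.univ (fun i : Fin n => h i.succ) φ (x + h 0) := by
  rw [Fin.univ_succ, Finset.cons_eq_insert, mixedDiff_insert, mixedDiff_map, mixedDiff_map]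
  · rfl
  · simp

theorem abs_mixedDiff_le {s : Finset ι} {h : ι → X} {φ : X → ℝ} {x : X} {C : ℝ}
    (hC : ∀ S ⊆ s, |φ (x + ∑ i ∈ S, h i)| ≤ C) : |mixedDiff s h φ x| ≤ 2 ^ s.card * C := by
  refine (Finset.abs_sum_le_sum_abs _ _).trans ?_
  refine (Finset.sum_le_card_nsmul _ _ C fun S hS => ?_).trans ?_
  · rw [abs_mul, abs_pow, abs_neg, abs_one, one_pow, one_mul]
    exact hC S (Finset.mem_powerset.1 hS)
  · rw [Finset.card_powerset, nsmul_eq_mul]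
    push_cast
    rfl

/-- Djoković's identity: mixed differences are combinations of iterated differences in one
direction, so they vanish if the latter do. -/
theorem mixedDiff_eq_zero_of_fwdDiff_iter_eq_zero [Module ℝ X] {n : ℕ} {φ : X → ℝ}
    (hφ : ∀ v y, (fwdDiff v)^[n] φ y = 0) (h : Fin n → X) (x : X) :
    mixedDiff Finset.univ h φ x = 0 := by
  -- In the `k`-th summand the step `h i` is scaled by `1 - k / (i + 1)`. For fixed `S` the sum over
  -- `k` is an `n`-th difference in one direction, hence zero; on the other hand every `k ≥ 1`
  -- annihilates the step of index `k - 1`, so only `k = 0` survives.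
  have key : ∑ k ∈ Finset.range (n + 1), ((-1 : ℝ) ^ (n - k) * (n.choose k : ℝ)) *
      mixedDiff Finset.univ (fun i : Fin n => (1 - (k : ℝ) / ((i : ℕ) + 1)) • h i) φ x = 0 := by
    calc _ = ∑ S ∈ (Finset.univ : Finset (Fin n)).powerset, (-1) ^ S.card *
          (fwdDiff (-∑ i ∈ S, (1 / ((i : ℕ) + 1) : ℝ) • h i))^[n] φ (x + ∑ i ∈ S, h i) := by
          simp only [fwdDiff_iter_eq_sum_shift, mixedDiff, Finset.mul_sum]
          rw [Finset.sum_comm]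
          refine Finset.sum_congr rfl fun S _ => Finset.sum_congr rfl fun k _ => ?_
          have : x + ∑ i ∈ S, (1 - (k : ℝ) / ((i : ℕ) + 1)) • h i =
              x + ∑ i ∈ S, h i + k • -∑ i ∈ S, (1 / ((i : ℕ) + 1) : ℝ) • h i := by
            rw [add_assoc, ← Nat.cast_smul_eq_nsmul ℝ, smul_neg, Finset.smul_sum,
              ← Finset.sum_neg_distrib, ← Finset.sum_add_distrib]
            congr 1
            refine Finset.sum_congr rfl fun i _ => ?_
            rw [smul_smul, sub_smul, one_smul, sub_eq_add_neg, mul_one_div]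
          rw [this, zsmul_eq_mul]
          push_cast
          ring
      _ = 0 := Finset.sum_eq_zero fun S _ => by rw [hφ, mul_zero]
  rw [Finset.sum_range_succ', Finset.sum_eq_zero, zero_add] at key
  · simp only [Nat.cast_zero, zero_div, sub_zero, one_smul, Nat.choose_zero_right, Nat.cast_one,
      mul_one] at key
    exact (mul_eq_zero.1 key).resolve_left (by simp)
  · intro k hk
    rw [mixedDiff_eq_zero_of_eq_zero (i := (⟨k, Finset.mem_range.1 hk⟩ : Fin n))
      (Finset.mem_univ _), mul_zero]
    have : (k : ℝ) + 1 ≠ 0 := by positivity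
    simp [this]

/-- With equal steps a summand depends only on the size `j` of `S`, and homogeneity turns the sum
into `(-1) ^ k` times the `k`-th difference of `j ^ k`, which is `k!`, times `φ v`. -/
theorem mixedDiff_const_of_homogeneous [Module ℝ X] {k : ℕ} {φ : X → ℝ}
    (hφ : ∀ (t : ℝ) v, φ (t • v) = t ^ k * φ v) (v : X) :
    mixedDiff Finset.univ (fun _ : Fin k => v) φ 0 = (-1) ^ k * k.factorial * φ v := by
  have h1 := congrFun (fwdDiff_iter_eq_factorial (R := ℝ) (n := k)) 0
  rw [fwdDiff_iter_eq_sum_shift] at h1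
  have h2 : mixedDiff Finset.univ (fun _ : Fin k => v) φ 0 =
      ∑ S ∈ (Finset.univ : Finset (Fin k)).powerset,
        (fun j : ℕ => (-1 : ℝ) ^ j * ((j : ℝ) ^ k * φ v)) S.card := by
    unfold mixedDiff
    refine Finset.sum_congr rfl fun S _ => ?_
    rw [Finset.sum_const, zero_add, ← Nat.cast_smul_eq_nsmul ℝ, hφ]
  rw [h2, Finset.sum_powerset_apply_card (fun j : ℕ => (-1 : ℝ) ^ j * ((j : ℝ) ^ k * φ v)),
    Finset.card_univ, Fintype.card_fin]
  have h3 : ((k.factorial : ℝ → ℝ) 0) = (k.factorial : ℝ) := rfl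
  rw [h3] at h1
  rw [← h1, Finset.mul_sum, Finset.sum_mul]
  refine Finset.sum_congr rfl fun j hj => ?_
  have hj : j ≤ k := Nat.lt_succ_iff.1 (Finset.mem_range.1 hj)
  have : (-1 : ℝ) ^ k * (-1) ^ (k - j) = (-1) ^ j := by
    rw [← pow_add, show k + (k - j) = 2 * (k - j) + j by omega, pow_add, pow_mul]
    simp
  rw [← this]
  simp only [nsmul_eq_mul, zsmul_eq_mul, zero_add, mul_one]
  push_cast
  ring

end MixedDifferences

/-! ### Polarization of homogeneous polynomials. -/

/-- Cauchy's functional equation: `|L ((n * c) • z)| ≤ K` gives `|L (c • z)| ≤ K / n` whenever `|c|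
≤ 1 / n`, so `c ↦ L (c • z)` is continuous and therefore linear. -/
theorem map_smul_of_additive_of_bounded {X : Type*} [AddCommGroup X] [Module ℝ X] {L : X → ℝ}
    (hadd : ∀ a b, L (a + b) = L a + L b) {z : X} {K : ℝ} (hK : ∀ c : ℝ, |c| ≤ 1 → |L (c • z)| ≤ K)
    (c : ℝ) : L (c • z) = c * L z := by
  let τ : ℝ →+ ℝ := AddMonoidHom.mk' (fun c => L (c • z)) fun a b => by
    change L ((a + b) • z) = L (a • z) + L (b • z)
    rw [add_smul, hadd]
  have hτ : Continuous τ := by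
    refine continuous_of_continuousAt_zero τ ?_
    rw [ContinuousAt, map_zero, Metric.tendsto_nhds_nhds]
    intro ε hε
    obtain ⟨n, hn⟩ := exists_nat_gt (K / ε)
    have hK0 : 0 ≤ K := (abs_nonneg _).trans (hK 0 (by simp))
    have hn0 : (0 : ℝ) < n := lt_of_le_of_lt (by positivity) hn
    refine ⟨1 / n, by positivity, fun {c} hc => ?_⟩
    rw [dist_zero_right, Real.norm_eq_abs] at hc ⊢
    have h1 := hK (n * c) (by
      rw [abs_mul, Nat.abs_cast]
      rw [lt_div_iff₀ hn0] at hc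
      linarith)
    have h2 : L ((n * c) • z) = n * τ c := by
      have := map_nsmul τ n c
      rw [nsmul_eq_mul, nsmul_eq_mul] at this
      exact this
    rw [h2, abs_mul, Nat.abs_cast] at h1
    rw [div_lt_iff₀ hε] at hn
    by_contra hcon
    push Not at hcon
    nlinarith
  have := map_real_smul τ hτ c 1
  simp only [smul_eq_mul, mul_one] at this
  change L (c • z) = c * L ((1 : ℝ) • z) at this
  rwa [one_smul] at this

section Polarization

variable {X : Type*} [NormedAddCommGroup X] [NormedSpace ℝ X]

theorem MultilinearMap.norm_le_of_polyball {k : ℕ} (A : MultilinearMap ℝ (fun _ : Fin k => X) ℝ)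
    {ρ K : ℝ} (hρ : 0 < ρ) (hA : ∀ m : Fin k → X, (∀ i, ‖m i‖ ≤ ρ) → |A m| ≤ K) (m : Fin k → X) :
    |A m| ≤ K / ρ ^ k * ∏ i, ‖m i‖ := by
  have hK : 0 ≤ K := (abs_nonneg _).trans (hA 0 fun i => by simpa using hρ.le)
  by_cases h0 : ∃ i, m i = 0
  · obtain ⟨i, hi⟩ := h0
    rw [A.map_coord_zero i hi, abs_zero]
    positivity
  · push Not at h0
    have h1 : m = fun i => (‖m i‖ / ρ) • ((ρ / ‖m i‖) • m i) := by
      ext i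
      have : ‖m i‖ ≠ 0 := norm_ne_zero_iff.2 (h0 i)
      rw [smul_smul, div_mul_div_cancel₀ hρ.ne', div_self this, one_smul]
    conv_lhs => rw [h1]
    rw [A.map_smul_univ, smul_eq_mul, abs_mul, Finset.prod_div_distrib, Finset.prod_const,
      Finset.card_univ, Fintype.card_fin]
    have h2 := hA (fun i => (ρ / ‖m i‖) • m i) fun i => by
      have : ‖m i‖ ≠ 0 := norm_ne_zero_iff.2 (h0 i)
      rw [norm_smul, norm_div, norm_norm, div_mul_cancel₀ _ this, Real.norm_of_nonneg hρ.le]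
    rw [abs_of_nonneg (by positivity)]
    calc (∏ i, ‖m i‖) / ρ ^ k * _ ≤ (∏ i, ‖m i‖) / ρ ^ k * K := by gcongr
      _ = _ := by ring

/-- A `k`-homogeneous function with vanishing `(k+1)`-st differences and a bound
`|P v| ≤ C ‖v‖ ^ k` is the diagonal of a continuous `k`-linear form, which is given by the mixed
differences at any base point. -/
theorem exists_continuousMultilinearMap_of_fwdDiff {k : ℕ} {P : X → ℝ} {C : ℝ}
    (hhom : ∀ (t : ℝ) v, P (t • v) = t ^ k * P v) (hbd : ∀ v, |P v| ≤ C * ‖v‖ ^ k)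
    (hP : ∀ v y, (fwdDiff v)^[k + 1] P y = 0) :
    ∃ A : ContinuousMultilinearMap ℝ (fun _ : Fin k => X) ℝ, (∀ v, A (fun _ => v) = P v) ∧
      ∀ m y, A m = (-1) ^ k / k.factorial * mixedDiff Finset.univ m P y := by
  -- The values at the bases `0` and `y` differ by a mixed difference of order `k + 1` with `y` as
  -- additional step, which vanishes by Djoković's identity.
  have hbase : ∀ (m : Fin k → X) y, mixedDiff Finset.univ m P y = mixedDiff Finset.univ m P 0 := by
    intro m y
    have h := mixedDiff_eq_zero_of_fwdDiff_iter_eq_zero hP (Fin.cons y m) 0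
    rw [mixedDiff_univ_succ] at h
    simp only [Fin.cons_succ, Fin.cons_zero, zero_add] at h
    linarith
  have hC : ∀ v, |P v| ≤ |C| * ‖v‖ ^ k := fun v =>
    (hbd v).trans (mul_le_mul_of_nonneg_right (le_abs_self C) (by positivity))
  have hupd : ∀ [DecidableEq (Fin k)] (m : Fin k → X) (i : Fin k) (z y : X),
      mixedDiff Finset.univ (Function.update m i z) P y =
        mixedDiff (Finset.univ.erase i) m P y - mixedDiff (Finset.univ.erase i) m P (y + z) := by
    intro _ m i z y
    have hcongr : ∀ j ∈ Finset.univ.erase i, Function.update m i z j = m j := fun j hj =>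
      Function.update_of_ne (Finset.ne_of_mem_erase hj) _ _
    conv_lhs => rw [← Finset.insert_erase (Finset.mem_univ i)]
    rw [mixedDiff_insert (Finset.notMem_erase _ _), Function.update_self,
      mixedDiff_congr hcongr, mixedDiff_congr hcongr]
  -- Taking the base point `a` for the step `b` makes the two differences in slot `i` telescope to
  -- the difference with step `a + b`.
  have hadd : ∀ [DecidableEq (Fin k)] (m : Fin k → X) (i : Fin k) (a b : X),
      mixedDiff Finset.univ (Function.update m i (a + b)) P 0 =
        mixedDiff Finset.univ (Function.update m i a) P 0 +
          mixedDiff Finset.univ (Function.update m i b) P 0 := by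
    intro _ m i a b
    have h1 := hbase (Function.update m i b) a
    rw [hupd, hupd, zero_add] at h1
    rw [hupd, hupd, hupd, zero_add, zero_add, zero_add]
    linarith
  have hsmul : ∀ [DecidableEq (Fin k)] (m : Fin k → X) (i : Fin k) (c : ℝ) (z : X),
      mixedDiff Finset.univ (Function.update m i (c • z)) P 0 =
        c * mixedDiff Finset.univ (Function.update m i z) P 0 := by
    intro _ m i c z
    refine map_smul_of_additive_of_bounded
      (L := fun z => mixedDiff Finset.univ (Function.update m i z) P 0) (fun a b => hadd m i a b)
      (K := 2 ^ (Finset.univ : Finset (Fin k)).card * (|C| * (∑ j, ‖m j‖ + ‖z‖) ^ k)) ?_ c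
    intro c hc
    refine abs_mixedDiff_le fun S _ => (hC _).trans ?_
    gcongr
    rw [zero_add]
    refine (norm_sum_le _ _).trans ?_
    calc ∑ j ∈ S, ‖Function.update m i (c • z) j‖
        ≤ ∑ j, ‖Function.update m i (c • z) j‖ :=
          Finset.sum_le_sum_of_subset_of_nonneg (Finset.subset_univ _) fun _ _ _ => norm_nonneg _
      _ ≤ ∑ j, (‖m j‖ + if j = i then ‖z‖ else 0) := by
          refine Finset.sum_le_sum fun j _ => ?_
          rcases eq_or_ne j i with rfl | hj
          · rw [Function.update_self, if_pos rfl, norm_smul, Real.norm_eq_abs]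
            nlinarith [norm_nonneg z, norm_nonneg (m j)]
          · rw [Function.update_of_ne hj, if_neg hj, add_zero]
      _ = _ := by rw [Finset.sum_add_distrib, Finset.sum_ite_eq' Finset.univ i]; simp
  let A : MultilinearMap ℝ (fun _ : Fin k => X) ℝ :=
    { toFun := fun m => (-1) ^ k / k.factorial * mixedDiff Finset.univ m P 0
      map_update_add' := fun m i a b => by rw [hadd, mul_add]
      map_update_smul' := fun m i c z => by rw [hsmul, smul_eq_mul]; ring }
  have hA : ∀ m : Fin k → X, (∀ i, ‖m i‖ ≤ 1) →
      |A m| ≤ |(-1 : ℝ) ^ k / k.factorial| * (2 ^ (Finset.univ : Finset (Fin k)).card *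
        (|C| * (k : ℝ) ^ k)) := by
    intro m hm
    change |(-1 : ℝ) ^ k / k.factorial * mixedDiff Finset.univ m P 0| ≤ _
    rw [abs_mul]
    gcongr
    refine abs_mixedDiff_le fun S _ => (hC _).trans ?_
    gcongr
    rw [zero_add]
    refine (norm_sum_le_of_le S fun i _ => hm i).trans ?_
    rw [Finset.sum_const, nsmul_eq_mul, mul_one]
    exact_mod_cast (Finset.card_le_univ S).trans (by simp)
  refine ⟨A.mkContinuous _ fun m => A.norm_le_of_polyball one_pos hA m, fun v => ?_, fun m y => ?_⟩
  · change (-1) ^ k / k.factorial * mixedDiff Finset.univ (fun _ => v) P 0 = _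
    rw [mixedDiff_const_of_homogeneous hhom]
    have h1 : (k.factorial : ℝ) ≠ 0 := by positivity
    have h2 : (-1 : ℝ) ^ k * (-1) ^ k = 1 := by rw [← mul_pow]; simp
    field_simp
    linear_combination P v * h2
  · change (-1) ^ k / k.factorial * mixedDiff Finset.univ m P 0 = _
    rw [hbase m y]

end Polarization

/-! ### Smooth curves through rapidly converging sequences. -/

/-- Special curve lemma: if `x n` and `v n` tend to zero fast enough, then there is a smooth curve
which near `(1/2) ^ n` runs through `x n` along a straight line with velocity `v n`. -/
theorem exists_smooth_curve_through (X : Type*) [NormedAddCommGroup X] [NormedSpace ℝ X]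
    [CompleteSpace X] : ∃ ε : ℕ → ℝ, (∀ n, 0 < ε n) ∧ ∀ δ > 0, ∀ x v : ℕ → X,
      (∀ n, ‖x n‖ ≤ δ * ε n) → (∀ n, ‖v n‖ ≤ δ * ε n) → ∃ γ : ℝ → X, ContDiff ℝ ∞ γ ∧
        (∀ t, ‖γ t‖ ≤ δ) ∧ γ 0 = 0 ∧
        ∀ n, ∀ᶠ s in 𝓝 (0 : ℝ), γ ((1 / 2) ^ n + s) = x n + s • v n := by
  have htp : ∀ n : ℕ, (0 : ℝ) < (1 / 2) ^ n := fun n => by positivity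
  let b : ∀ n : ℕ, ContDiffBump ((1 / 2 : ℝ) ^ n) := fun n =>
    ⟨(1 / 2) ^ n / 16, (1 / 2) ^ n / 8, by positivity, by linarith [htp n]⟩
  let ψ : ℕ → ℝ → ℝ := fun n t => (t - (1 / 2) ^ n) * b n t
  have hb : ∀ n, ContDiff ℝ ∞ (b n : ℝ → ℝ) := fun n => (b n).contDiff
  have hψ : ∀ n, ContDiff ℝ ∞ (ψ n) := fun n => (contDiff_id.sub contDiff_const).mul (hb n)
  have hbs : ∀ n, HasCompactSupport (b n : ℝ → ℝ) := fun n => (b n).hasCompactSupport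
  have hψs : ∀ n, HasCompactSupport (ψ n) := fun n => (hbs n).mul_left
  have hD : ∀ n k : ℕ, ∃ D : ℝ, ∀ t, ‖iteratedFDeriv ℝ k (b n : ℝ → ℝ) t‖ ≤ D ∧
      ‖iteratedFDeriv ℝ k (ψ n) t‖ ≤ D := by
    intro n k
    obtain ⟨D₁, h₁⟩ := ((hbs n).iteratedFDeriv (𝕜 := ℝ) k).exists_bound_of_continuous
      ((hb n).continuous_iteratedFDeriv (by exact_mod_cast le_top))
    obtain ⟨D₂, h₂⟩ := ((hψs n).iteratedFDeriv (𝕜 := ℝ) k).exists_bound_of_continuous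
      ((hψ n).continuous_iteratedFDeriv (by exact_mod_cast le_top))
    exact ⟨max D₁ D₂, fun t => ⟨(h₁ t).trans (le_max_left _ _), (h₂ t).trans (le_max_right _ _)⟩⟩
  choose D hD using hD
  have hD0 : ∀ n k, 0 ≤ D n k := fun n k => (norm_nonneg _).trans (hD n k 0).1
  have hS0 : ∀ n, 0 < 1 + ∑ k ∈ Finset.range (n + 1), D n k := fun n =>
    add_pos_of_pos_of_nonneg one_pos (Finset.sum_nonneg fun k _ => hD0 n k)
  -- Chosen so that the derivatives of order `k ≤ n` of the `n`-th summand are at most `δ / 2 / 2 ^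
  -- n`. These bounds sum to `δ`, and for each fixed `k` only finitely many summands escape them.
  refine ⟨fun n => (1 / 2) ^ n / 4 / (1 + ∑ k ∈ Finset.range (n + 1), D n k),
    fun n => div_pos (by positivity) (hS0 n), fun δ hδ x v hx hv => ?_⟩
  let f : ℕ → ℝ → X := fun n t => b n t • x n + ψ n t • v n
  have hf₁ : ∀ n, ContDiff ℝ ∞ fun t => b n t • x n := fun n => (hb n).smul contDiff_const
  have hf₂ : ∀ n, ContDiff ℝ ∞ fun t => ψ n t • v n := fun n => (hψ n).smul contDiff_const
  have hf : ∀ n, ContDiff ℝ ∞ (f n) := fun n => (hf₁ n).add (hf₂ n)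
  have hsmul : ∀ (g : ℝ → ℝ) (y : X) (k : ℕ) (t : ℝ), ContDiff ℝ ∞ g →
      ‖iteratedFDeriv ℝ k (fun t => g t • y) t‖ ≤ ‖iteratedFDeriv ℝ k g t‖ * ‖y‖ := by
    intro g y k t hg
    have := (ContinuousLinearMap.toSpanSingleton ℝ y).norm_iteratedFDeriv_comp_left
      (hg.contDiffAt (x := t)) (n := k) (by exact_mod_cast le_top)
    rw [ContinuousLinearMap.norm_toSpanSingleton, mul_comm] at this
    exact this
  have hbound : ∀ n k, k ≤ n → ∀ t, ‖iteratedFDeriv ℝ k (f n) t‖ ≤ δ / 2 / 2 ^ n := by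
    intro n k hk t
    have h0 : iteratedFDeriv ℝ k (f n) t = iteratedFDeriv ℝ k (fun t => b n t • x n) t +
        iteratedFDeriv ℝ k (fun t => ψ n t • v n) t :=
      congrFun (iteratedFDeriv_add ((hf₁ n).of_le (by exact_mod_cast le_top))
        ((hf₂ n).of_le (by exact_mod_cast le_top))) t
    rw [h0]
    have hDk : D n k ≤ 1 + ∑ k ∈ Finset.range (n + 1), D n k := by
      have := Finset.single_le_sum (f := D n) (fun k _ => hD0 n k)
        (Finset.mem_range.2 (Nat.lt_succ_of_le hk))
      linarith
    have hy : ∀ y : X, ‖y‖ ≤ δ * ((1 / 2) ^ n / 4 / (1 + ∑ k ∈ Finset.range (n + 1), D n k)) →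
        D n k * ‖y‖ ≤ δ / 4 / 2 ^ n := by
      intro y hy
      calc D n k * ‖y‖ ≤ (1 + ∑ k ∈ Finset.range (n + 1), D n k) *
            (δ * ((1 / 2) ^ n / 4 / (1 + ∑ k ∈ Finset.range (n + 1), D n k))) := by
            gcongr
            exact (hS0 n).le
        _ = δ / 4 / 2 ^ n := by
            have := (hS0 n).ne'
            rw [div_pow, one_pow]
            field_simp
    have h1 := (hsmul (b n) (x n) k t (hb n)).trans
      ((mul_le_mul_of_nonneg_right (hD n k t).1 (norm_nonneg _)).trans (hy _ (hx n)))
    have h2 := (hsmul (ψ n) (v n) k t (hψ n)).trans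
      ((mul_le_mul_of_nonneg_right (hD n k t).2 (norm_nonneg _)).trans (hy _ (hv n)))
    refine (norm_add_le_of_le h1 h2).trans (le_of_eq (by ring))
  have hzero : ∀ n t, (1 / 2 : ℝ) ^ n / 8 ≤ dist t ((1 / 2) ^ n) → f n t = 0 := by
    intro n t ht
    have : b n t = 0 := (b n).zero_of_le_dist ht
    simp [f, ψ, this]
  refine ⟨fun t => ∑' n, f n t, ?_, fun t => ?_, ?_, fun n => ?_⟩
  · refine contDiff_tsum_of_eventually (N := (⊤ : ℕ∞)) (v := fun _ n => δ / 2 / 2 ^ n) hf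
      (fun k _ => summable_geometric_two' δ) fun k _ => ?_
    rw [Nat.cofinite_eq_atTop]
    filter_upwards [eventually_ge_atTop k] with n hn t using hbound n k hn t
  · refine tsum_of_norm_bounded (hasSum_geometric_two' δ) fun n => ?_
    rw [← norm_iteratedFDeriv_zero (𝕜 := ℝ)]
    exact hbound n 0 (Nat.zero_le n) t
  · have : ∀ n, f n 0 = 0 := fun n => hzero n 0 (by
      rw [dist_zero_left, Real.norm_of_nonneg (htp n).le]; linarith [htp n])
    simp [this]
  · filter_upwards [Metric.ball_mem_nhds (0 : ℝ) (show (0 : ℝ) < (1 / 2) ^ n / 16 by positivity)]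
      with s hs
    rw [Metric.mem_ball, dist_zero_right, Real.norm_eq_abs] at hs
    have h1 := abs_lt.1 hs
    have hle : ∀ i j : ℕ, i < j → (1 / 2 : ℝ) ^ j ≤ (1 / 2) ^ i / 2 := by
      intro i j hij
      calc (1 / 2 : ℝ) ^ j ≤ (1 / 2) ^ (i + 1) :=
            pow_le_pow_of_le_one (by norm_num) (by norm_num) hij
        _ = _ := by ring
    -- The supports are disjoint: the centres decrease by factors of two, while the outer radii are
    -- an eighth of the centres.
    rw [tsum_eq_single n]
    · have hone : b n ((1 / 2) ^ n + s) = 1 := (b n).one_of_mem_closedBall (by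
        rw [Metric.mem_closedBall, Real.dist_eq, add_sub_cancel_left]
        exact hs.le)
      change b n _ • x n + (_ * b n _) • v n = _
      rw [hone, add_sub_cancel_left, mul_one, one_smul]
    · intro m hm
      refine hzero m _ ?_
      rw [Real.dist_eq, le_abs]
      rcases lt_or_gt_of_ne hm with h | h
      · right
        linarith [hle m n h, htp m, htp n]
      · left
        linarith [hle n m h, htp m, htp n]

/-! ### Hartogs' theorem in Banach spaces. -/

theorem iteratedDeriv_comp_mul_left (n : ℕ) (c : ℝ) (g : ℝ → ℝ) (x : ℝ) :
    iteratedDeriv n (fun t => g (c * t)) x = c ^ n * iteratedDeriv n g (c * x) := by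
  induction n generalizing x with
  | zero => simp
  | succ n ih =>
    rw [iteratedDeriv_succ, iteratedDeriv_succ, funext ih, deriv_const_mul_field,
      deriv_comp_mul_left c (iteratedDeriv n g) x, smul_eq_mul]
    ring

/-- An `n`-th difference of a function with `n`-th derivative bounded by `C`. -/
theorem abs_sum_shift_le {g : ℝ → ℝ} {n : ℕ} {t C : ℝ}
    (hg : ∀ s, |s| ≤ (n + 1) * |t| → ContDiffAt ℝ (n + 1) g s)
    (hC : ∀ s, |s| ≤ (n + 1) * |t| → |iteratedDeriv (n + 1) g s| ≤ C) :
    |∑ j ∈ Finset.range (n + 2), ((-1 : ℝ) ^ (n + 1 - j) * ((n + 1).choose j : ℝ)) * g (j * t)| ≤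
      (∑ j ∈ Finset.range (n + 2), ((n + 1).choose j : ℝ)) * (C * (n + 1) ^ (n + 1)) *
        |t| ^ (n + 1) := by
  set T : ℝ → ℝ := fun s => ∑ k ∈ Finset.range (n + 1), iteratedDeriv k g 0 / k.factorial * s ^ k
  -- Differences of order `n + 1` annihilate polynomials of degree at most `n`, so only the Taylor
  -- remainder of `g` contributes.
  have hT : ∑ j ∈ Finset.range (n + 2), ((-1 : ℝ) ^ (n + 1 - j) * ((n + 1).choose j : ℝ)) *
      T (j * t) = 0 := by
    have h := congrFun (fwdDiff_iter_sum_mul_pow_eq_zero (n := n + 1)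
      fun k => iteratedDeriv k g 0 / k.factorial * t ^ k) 0
    rw [fwdDiff_iter_eq_sum_shift, Pi.zero_apply] at h
    rw [← h]
    refine Finset.sum_congr rfl fun j _ => ?_
    simp only [T, zsmul_eq_mul, nsmul_eq_mul, zero_add, mul_one]
    push_cast
    congr 1
    exact Finset.sum_congr rfl fun k _ => by rw [mul_pow]; ring
  have hC0 : 0 ≤ C := (abs_nonneg _).trans (hC 0 (by rw [abs_zero]; positivity))
  rw [← sub_zero (∑ j ∈ Finset.range (n + 2), _), ← hT, ← Finset.sum_sub_distrib, Finset.sum_mul,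
    Finset.sum_mul]
  refine (Finset.abs_sum_le_sum_abs _ _).trans (Finset.sum_le_sum fun j hj => ?_)
  rw [← mul_sub, abs_mul, abs_mul, abs_pow, abs_neg, abs_one, one_pow, one_mul, Nat.abs_cast,
    mul_assoc]
  gcongr
  have hj : (j : ℝ) ≤ n + 1 := by
    have := Finset.mem_range.1 hj
    exact_mod_cast (by omega : j ≤ n + 1)
  have hmem : ∀ s ∈ Set.uIcc (0 : ℝ) (j * t), |s| ≤ (n + 1) * |t| := by
    intro s hs
    have h1 := Set.abs_sub_left_of_mem_uIcc hs
    simp only [sub_zero] at h1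
    rw [abs_mul, Nat.abs_cast] at h1
    exact h1.trans (by gcongr)
  have h := abs_sub_taylor_le (n := n) (x₀ := 0) (x := j * t) (fun s hs => hg s (hmem s hs))
    fun s hs => hC s (hmem s hs)
  simp only [sub_zero] at h
  refine h.trans ?_
  rw [abs_mul, Nat.abs_cast, mul_pow]
  have h1 : (1 : ℝ) ≤ (n + 1).factorial := by exact_mod_cast Nat.factorial_pos _
  calc C * ((j : ℝ) ^ (n + 1) * |t| ^ (n + 1)) / (n + 1).factorial
      ≤ C * ((j : ℝ) ^ (n + 1) * |t| ^ (n + 1)) := div_le_self (by positivity) h1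
    _ ≤ C * (((n : ℝ) + 1) ^ (n + 1) * |t| ^ (n + 1)) := by gcongr
    _ = _ := by ring

section Banach

variable {X : Type*} [NormedAddCommGroup X] [NormedSpace ℝ X]

/-- The `k`-th Taylor coefficient of `h` at `0` in direction `v`. -/
noncomputable def dirTaylor (h : X → ℝ) (k : ℕ) (v : X) : ℝ :=
  iteratedDeriv k (fun t : ℝ => h (t • v)) 0 / k.factorial

theorem dirTaylor_smul (h : X → ℝ) (k : ℕ) (c : ℝ) (v : X) :
    dirTaylor h k (c • v) = c ^ k * dirTaylor h k v := by
  have : (fun t : ℝ => h (t • c • v)) = fun t => (fun t : ℝ => h (t • v)) (c * t) := by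
    ext t; simp only [smul_smul, mul_comm]
  unfold dirTaylor
  rw [this, iteratedDeriv_comp_mul_left k c fun t : ℝ => h (t • v), mul_zero]
  ring

/-- Otherwise there are points `x n` tending rapidly to `0` and directions of norm at most `1` in
which the derivative explodes. A smooth curve passing through all `x n` in these directions then has
a composite with `h` whose `p`-th derivative is unbounded near `0`. -/
theorem exists_bound_iteratedDeriv_dir [CompleteSpace X] {h : X → ℝ} {δ : ℝ} (hδ : 0 < δ)
    (hsm : ∀ γ : ℝ → X, ContDiff ℝ ∞ γ → (∀ t, ‖γ t‖ < δ) → ContDiff ℝ ∞ fun t => h (γ t)) (p : ℕ) :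
    ∃ r > 0, ∃ C, ∀ x v : X, ‖x‖ < r →
      |iteratedDeriv p (fun t : ℝ => h (x + t • v)) 0| ≤ C * ‖v‖ ^ p := by
  have hscale : ∀ (x v : X) (c : ℝ), iteratedDeriv p (fun t : ℝ => h (x + t • c • v)) 0 =
      c ^ p * iteratedDeriv p (fun t : ℝ => h (x + t • v)) 0 := by
    intro x v c
    have : (fun t : ℝ => h (x + t • c • v)) = fun t => (fun t : ℝ => h (x + t • v)) (c * t) := by
      ext t; simp only [smul_smul, mul_comm]
    rw [this, iteratedDeriv_comp_mul_left p c fun t : ℝ => h (x + t • v), mul_zero]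
  suffices hs : ∃ r > 0, ∃ C, ∀ x v : X, ‖x‖ < r → ‖v‖ ≤ 1 →
      |iteratedDeriv p (fun t : ℝ => h (x + t • v)) 0| ≤ C by
    obtain ⟨r, hr, C, hC⟩ := hs
    refine ⟨r, hr, C, fun x v hx => ?_⟩
    rcases eq_or_ne v 0 with rfl | hv
    · have h0 := hscale x 0 0
      rw [smul_zero] at h0
      rw [h0, abs_mul, abs_pow, abs_zero, norm_zero, mul_comm]
      exact mul_le_mul_of_nonneg_right (hC x 0 hx (by simp)) (by positivity)
    · have hv' : ‖v‖ ≠ 0 := norm_ne_zero_iff.2 hv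
      have h1 := hscale x (‖v‖⁻¹ • v) ‖v‖
      rw [smul_smul, mul_inv_cancel₀ hv', one_smul] at h1
      rw [h1, abs_mul, abs_pow, abs_norm, mul_comm]
      refine mul_le_mul_of_nonneg_right (hC x _ hx ?_) (by positivity)
      rw [norm_smul, norm_inv, norm_norm, inv_mul_cancel₀ hv']
  by_contra hcon
  push Not at hcon
  obtain ⟨ε, hε, H⟩ := exists_smooth_curve_through X
  have hμ : ∀ n, 0 < δ / 2 * ε n := fun n => mul_pos (half_pos hδ) (hε n)
  -- The curve has velocity `(δ / 2 * ε n) • v n`, which scales the `p`-th derivative by `(δ / 2 * ε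
  -- n) ^ p`; the inverse factor in the bound compensates and leaves a derivative larger than `n`.
  choose x v hx hv hbig using fun n => hcon (δ / 2 * ε n) (hμ n) (n * ((δ / 2 * ε n) ^ p)⁻¹)
  obtain ⟨γ, hγ, hγδ, -, hγx⟩ := H (δ / 2) (half_pos hδ) x (fun n => (δ / 2 * ε n) • v n)
    (fun n => (hx n).le) fun n => by
      rw [norm_smul, Real.norm_of_nonneg (hμ n).le]
      exact mul_le_of_le_one_right (hμ n).le (hv n)
  have hc := hsm γ hγ fun t => (hγδ t).trans_lt (half_lt_self hδ)
  have hcont : Continuous (iteratedDeriv p fun t => h (γ t)) :=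
    hc.continuous_iteratedDeriv p (by exact_mod_cast le_top)
  have hval : ∀ n : ℕ, (n : ℝ) < |iteratedDeriv p (fun t => h (γ t)) ((1 / 2) ^ n)| := by
    intro n
    have h1 : (fun s : ℝ => h (γ ((1 / 2) ^ n + s))) =ᶠ[𝓝 0]
        fun s => h (x n + s • (δ / 2 * ε n) • v n) := by
      filter_upwards [hγx n] with s hs
      rw [hs]
    have h2 := h1.iteratedDeriv_eq p
    rw [iteratedDeriv_comp_const_add p (fun t => h (γ t)), hscale] at h2
    simp only [add_zero] at h2
    rw [h2, abs_mul, abs_of_pos (pow_pos (hμ n) p)]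
    have h3 := hbig n
    rwa [mul_inv_lt_iff₀ (pow_pos (hμ n) p), mul_comm] at h3
  have hlim : Tendsto (fun n : ℕ => |iteratedDeriv p (fun t => h (γ t)) ((1 / 2) ^ n)|) atTop
      (𝓝 |iteratedDeriv p (fun t => h (γ t)) 0|) :=
    (hcont.abs.tendsto 0).comp (tendsto_pow_atTop_nhds_zero_of_lt_one (by norm_num) (by norm_num))
  exact not_tendsto_nhds_of_tendsto_atTop
    (tendsto_atTop_mono (fun n => (hval n).le) tendsto_natCast_atTop_atTop) _ hlim

theorem abs_dirTaylor_le {h : X → ℝ} {k : ℕ} {r C : ℝ} (hr : 0 < r)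
    (hC : ∀ x v : X, ‖x‖ < r → |iteratedDeriv k (fun t : ℝ => h (x + t • v)) 0| ≤ C * ‖v‖ ^ k)
    (v : X) : |dirTaylor h k v| ≤ C / k.factorial * ‖v‖ ^ k := by
  have := hC 0 v (by simpa using hr)
  simp only [zero_add] at this
  unfold dirTaylor
  rw [abs_div, Nat.abs_cast, div_mul_eq_mul_div]
  gcongr

/-- Consider `E t = ∑ ± binom(k + 1, j) h (t y + j t v)`. Its `k`-th Taylor coefficient at `0` is
the difference in question. It is also a `(k + 1)`-st difference of step `t` along the line through
`t y` in direction `v`, where the derivative of order `k + 1` is bounded uniformly in `t`. So `E` is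
`O(t ^ (k + 1))`, and the coefficient vanishes. -/
theorem fwdDiff_iter_dirTaylor [CompleteSpace X] {h : X → ℝ} {δ : ℝ} (hδ : 0 < δ)
    (hsm : ∀ γ : ℝ → X, ContDiff ℝ ∞ γ → (∀ t, ‖γ t‖ < δ) → ContDiff ℝ ∞ fun t => h (γ t))
    (hln : ∀ y v : X, ∀ t : ℝ, ‖y + t • v‖ < δ → AnalyticAt ℝ (fun t : ℝ => h (y + t • v)) t)
    (k : ℕ) (v y : X) : (fwdDiff v)^[k + 1] (dirTaylor h k) y = 0 := by
  obtain ⟨r, hr, C, hC⟩ := exists_bound_iteratedDeriv_dir hδ hsm (k + 1)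
  set c : ℕ → ℝ := fun j => (-1 : ℝ) ^ (k + 1 - j) * ((k + 1).choose j : ℝ)
  have hsmooth : ∀ z : X, ∀ n : ℕ, ContDiffAt ℝ n (fun t : ℝ => h (t • z)) 0 := by
    intro z n
    have := (hln 0 z 0 (by simpa using hδ)).contDiffAt (n := (n : WithTop ℕ∞))
    simpa only [zero_add] using this
  set E : ℝ → ℝ := fun t => ∑ j ∈ Finset.range (k + 2), c j * h (t • (y + (j : ℝ) • v))
  have hE1 : ContDiffAt ℝ (k + 1) E 0 :=
    ContDiffAt.sum fun j _ => contDiffAt_const.mul (by exact_mod_cast hsmooth _ (k + 1))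
  have hE2 : iteratedDeriv k E 0 = k.factorial * (fwdDiff v)^[k + 1] (dirTaylor h k) y := by
    rw [iteratedDeriv_fun_sum fun j _ => contDiffAt_const.mul (hsmooth _ k),
      fwdDiff_iter_eq_sum_shift, Finset.mul_sum]
    refine Finset.sum_congr rfl fun j _ => ?_
    rw [iteratedDeriv_const_mul _ (hsmooth _ k), zsmul_eq_mul, ← Nat.cast_smul_eq_nsmul ℝ j v]
    unfold dirTaylor
    have : (k.factorial : ℝ) ≠ 0 := by positivity
    simp only [c]
    push_cast
    field_simp
  have hE3 : E =O[𝓝 0] fun t => (t - 0) ^ (k + 1) := by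
    have hsmall : ∀ᶠ t : ℝ in 𝓝 0, |t| * (‖y‖ + (k + 1) * ‖v‖) < min r δ := by
      have : Tendsto (fun t : ℝ => |t| * (‖y‖ + (k + 1) * ‖v‖)) (𝓝 0)
          (𝓝 (|0| * (‖y‖ + (k + 1) * ‖v‖))) :=
        (continuous_abs.mul continuous_const).tendsto 0
      rw [abs_zero, zero_mul] at this
      exact this.eventually_lt_const (lt_min hr hδ)
    refine Asymptotics.IsBigO.of_bound ((∑ j ∈ Finset.range (k + 2), ((k + 1).choose j : ℝ)) *
      ((C * ‖v‖ ^ (k + 1)) * (k + 1) ^ (k + 1))) ?_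
    filter_upwards [hsmall] with t ht
    have hball : ∀ s : ℝ, |s| ≤ (k + 1) * |t| → ‖t • y + s • v‖ < min r δ := by
      intro s hs
      refine lt_of_le_of_lt ?_ ht
      refine (norm_add_le _ _).trans ?_
      rw [norm_smul, norm_smul, Real.norm_eq_abs, Real.norm_eq_abs, mul_add]
      have : |s| * ‖v‖ ≤ (k + 1) * |t| * ‖v‖ := by gcongr
      linarith
    have := abs_sum_shift_le (g := fun s : ℝ => h (t • y + s • v)) (n := k) (t := t)
      (C := C * ‖v‖ ^ (k + 1))
      (fun s hs => (hln (t • y) v s ((hball s hs).trans_le (min_le_right _ _))).contDiffAt)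
      (fun s hs => by
        have h1 := hC (t • y + s • v) v ((hball s hs).trans_le (min_le_left _ _))
        have h2 : (fun u : ℝ => h (t • y + s • v + u • v)) =
            fun u => (fun u : ℝ => h (t • y + u • v)) (s + u) := by
          ext u; simp only [add_smul, add_assoc]
        rw [h2, iteratedDeriv_comp_const_add (k + 1) fun u : ℝ => h (t • y + u • v)] at h1
        simpa only [add_zero] using h1)
    rw [Real.norm_eq_abs, norm_pow, Real.norm_eq_abs, sub_zero]
    refine le_trans (le_of_eq ?_) this
    congr 1
    refine Finset.sum_congr rfl fun j _ => ?_
    rw [smul_add, smul_smul, mul_comm t]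
  have h0 := iteratedDeriv_eq_zero_of_isBigO hE1 hE3 k le_rfl
  rw [hE2] at h0
  exact (mul_eq_zero.1 h0).resolve_left (by positivity)

theorem hasSum_dirTaylor {h : X → ℝ} {v : X} (hv : AnalyticAt ℝ (fun t : ℝ => h (t • v)) 0) :
    ∀ᶠ t : ℝ in 𝓝 0, HasSum (fun n => t ^ n * dirTaylor h n v) (h (t • v)) := by
  have := hasFPowerSeriesAt_iff.1 hv.hasFPowerSeriesAt
  simpa only [FormalMultilinearSeries.coeff_ofScalars, smul_eq_mul, zero_add,
    dirTaylor] using this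

/-- One natural number dominates both constants of the geometric bound, so that countably many
closed sets suffice for Baire's theorem. -/
theorem exists_bound_dirTaylor {h : X → ℝ} {v : X}
    (hv : AnalyticAt ℝ (fun t : ℝ => h (t • v)) 0) :
    ∃ N : ℕ, ∀ k, |dirTaylor h k v| ≤ (N : ℝ) ^ (k + 1) := by
  obtain ⟨C, r, hC, hr, hb⟩ := FormalMultilinearSeries.le_mul_pow_of_radius_pos _
    hv.hasFPowerSeriesAt.radius_pos
  obtain ⟨N, hN⟩ := exists_nat_ge (max C r)
  refine ⟨N, fun k => ?_⟩
  have h1 := hb k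
  rw [FormalMultilinearSeries.ofScalars_norm] at h1
  calc |dirTaylor h k v| ≤ C * r ^ k := h1
    _ ≤ N * N ^ k := by
        gcongr
        · exact (le_max_left _ _).trans hN
        · exact (le_max_right _ _).trans hN
    _ = _ := by ring

/-- A function on a neighborhood of `0` in a Banach space which is smooth along smooth curves and
real analytic along affine lines is real analytic. -/
theorem analyticAt_of_smooth_of_analyticAlongLines [CompleteSpace X] {h : X → ℝ} {δ : ℝ}
    (hδ : 0 < δ)
    (hsm : ∀ γ : ℝ → X, ContDiff ℝ ∞ γ → (∀ t, ‖γ t‖ < δ) → ContDiff ℝ ∞ fun t => h (γ t))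
    (hln : ∀ y v : X, ∀ t : ℝ, ‖y + t • v‖ < δ → AnalyticAt ℝ (fun t : ℝ => h (y + t • v)) t) :
    AnalyticAt ℝ h 0 := by
  have hln0 : ∀ v : X, ∀ t : ℝ, ‖t • v‖ < δ → AnalyticAt ℝ (fun t : ℝ => h (t • v)) t := by
    intro v t ht
    simpa only [zero_add] using hln 0 v t (by simpa using ht)
  have hA : ∀ k, ∃ A : ContinuousMultilinearMap ℝ (fun _ : Fin k => X) ℝ,
      (∀ v, A (fun _ => v) = dirTaylor h k v) ∧
      ∀ m y, A m = (-1) ^ k / k.factorial * mixedDiff Finset.univ m (dirTaylor h k) y := by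
    intro k
    obtain ⟨r, hr, C, hC⟩ := exists_bound_iteratedDeriv_dir hδ hsm k
    exact exists_continuousMultilinearMap_of_fwdDiff (dirTaylor_smul h k)
      (abs_dirTaylor_le hr hC) (fwdDiff_iter_dirTaylor hδ hsm hln k)
  choose p hpd hpm using hA
  have hclosed : ∀ N : ℕ, IsClosed {v : X | ∀ k, |dirTaylor h k v| ≤ (N : ℝ) ^ (k + 1)} := by
    intro N
    rw [Set.ofPred_forall]
    refine isClosed_iInter fun k => isClosed_le ?_ continuous_const
    simp only [← hpd]
    exact ((p k).cont.comp (continuous_pi fun _ => continuous_id)).abs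
  obtain ⟨N, y₀, hy₀⟩ := nonempty_interior_of_iUnion_of_closed hclosed (by
    rw [Set.eq_univ_iff_forall]
    intro v
    rw [Set.mem_iUnion]
    exact exists_bound_dirTaylor (hln0 v 0 (by simpa using hδ)))
  obtain ⟨η, hη, hball⟩ := Metric.isOpen_iff.1 isOpen_interior y₀ hy₀
  have hNball : ∀ y : X, ‖y‖ < η → ∀ k, |dirTaylor h k (y₀ + y)| ≤ (N : ℝ) ^ (k + 1) := by
    intro y hy
    exact interior_subset (hball (by simpa [Metric.mem_ball, dist_eq_norm] using hy))
  have hnorm : ∀ k, ‖p k‖ ≤ N * Real.exp 1 * (4 * N * Real.exp 1 / η) ^ k := by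
    intro k
    -- A sum of at most `k` steps of this size stays in the ball of radius `η`, so the mixed
    -- difference based at `y₀` sees only the values bounded by Baire's theorem.
    have hρ : 0 < η / (2 * (k + 1)) := by positivity
    have hpoly : ∀ m : Fin k → X, (∀ i, ‖m i‖ ≤ η / (2 * (k + 1))) →
        |p k m| ≤ 1 / k.factorial * (2 ^ k * (N : ℝ) ^ (k + 1)) := by
      intro m hm
      rw [hpm k m y₀, abs_mul, abs_div, abs_pow, abs_neg, abs_one, one_pow, Nat.abs_cast]
      gcongr
      refine (abs_mixedDiff_le (C := (N : ℝ) ^ (k + 1)) fun S _ => hNball _ ?_ k).trans_eq (by simp)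
      refine (norm_sum_le_of_le S fun i _ => hm i).trans_lt ?_
      rw [Finset.sum_const, nsmul_eq_mul]
      have hS : (S.card : ℝ) ≤ k := by exact_mod_cast (Finset.card_le_univ S).trans (by simp)
      calc (S.card : ℝ) * (η / (2 * (k + 1))) ≤ k * (η / (2 * (k + 1))) := by gcongr
        _ < η := by
          rw [mul_div_assoc', div_lt_iff₀ (by positivity)]
          nlinarith
    refine ContinuousMultilinearMap.opNorm_le_bound (by positivity) fun m => ?_
    refine ((p k).toMultilinearMap.norm_le_of_polyball hρ hpoly m).trans ?_
    gcongr
    -- The factor `(k + 1) ^ k` caused by the shrinking polyball is absorbed by `k!` up to a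
    -- geometric factor.
    have h1 := Real.pow_div_factorial_le_exp ((k : ℝ) + 1) (by positivity) k
    have h2 : Real.exp ((k : ℝ) + 1) = Real.exp 1 * Real.exp 1 ^ k := by
      rw [← Real.exp_nat_mul, ← Real.exp_add]; congr 1; ring
    rw [h2] at h1
    calc 1 / (k.factorial : ℝ) * (2 ^ k * (N : ℝ) ^ (k + 1)) / (η / (2 * (k + 1))) ^ k
        = N * (4 * N / η) ^ k * (((k : ℝ) + 1) ^ k / k.factorial) := by
          have : (4 : ℝ) ^ k = 2 ^ k * 2 ^ k := by rw [← mul_pow]; norm_num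
          rw [div_pow, div_pow, mul_pow, mul_pow, this]
          field_simp
          rw [pow_succ']
      _ ≤ N * (4 * N / η) ^ k * (Real.exp 1 * Real.exp 1 ^ k) := by gcongr
      _ = _ := by rw [mul_div_right_comm, mul_pow]; ring
  let q : FormalMultilinearSeries ℝ X ℝ := p
  obtain ⟨r, hr, hrq, hrδ⟩ : ∃ r : ℝ, 0 < r ∧ ENNReal.ofReal r ≤ q.radius ∧ r ≤ δ := by
    set R := 4 * N * Real.exp 1 / η
    have hR : 0 ≤ R := by positivity
    refine ⟨min (1 / (R + 1)) δ, lt_min (by positivity) hδ, ?_, min_le_right _ _⟩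
    refine (ENNReal.ofReal_le_ofReal (min_le_left _ _)).trans ?_
    refine q.le_radius_of_bound (N * Real.exp 1) fun n => ?_
    rw [Real.coe_toNNReal _ (by positivity)]
    calc ‖q n‖ * (1 / (R + 1)) ^ n ≤ N * Real.exp 1 * R ^ n * (1 / (R + 1)) ^ n := by
          gcongr
          exact hnorm n
      _ = N * Real.exp 1 * (R / (R + 1)) ^ n := by rw [mul_assoc, ← mul_pow, mul_one_div]
      _ ≤ N * Real.exp 1 * 1 := by
          gcongr
          exact pow_le_one₀ (by positivity) ((div_le_one (by positivity)).2 (by linarith))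
      _ = _ := mul_one _
  have hq0 : 0 < q.radius := (ENNReal.ofReal_pos.2 hr).trans_le hrq
  have hmem : ∀ y : X, ‖y‖ < r → y ∈ Metric.eball (0 : X) q.radius := by
    intro y hy
    refine Metric.eball_subset_eball hrq ?_
    rw [Metric.eball_ofReal]
    simpa using hy
  refine (q.hasFPowerSeriesOnBall hq0).analyticAt.congr ?_
  filter_upwards [Metric.ball_mem_nhds (0 : X) hr] with y hy
  rw [Metric.mem_ball, dist_zero_right] at hy
  set S : Set ℝ := {t | ‖t • y‖ < r}
  have hS : IsPreconnected S := by
    have : S = (LinearMap.toSpanSingleton ℝ X y) ⁻¹' Metric.ball 0 r := by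
      ext t; simp [S]
    rw [this]
    exact ((convex_ball (0 : X) r).linear_preimage _).isPreconnected
  have h0S : (0 : ℝ) ∈ S := by simpa [S] using hr
  have h1S : (1 : ℝ) ∈ S := by simpa [S] using hy
  have hφ : AnalyticOnNhd ℝ (fun t : ℝ => h (t • y)) S := fun t ht =>
    hln0 y t (lt_of_lt_of_le ht hrδ)
  have hψ : AnalyticOnNhd ℝ (fun t : ℝ => q.sum (t • y)) S := fun t ht => by
    refine AnalyticAt.comp_of_eq
      ((q.hasFPowerSeriesOnBall hq0).analyticOnNhd _ (hmem _ ht)) ?_ rfl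
    exact ((ContinuousLinearMap.toSpanSingleton ℝ y).analyticAt t)
  -- The directional Taylor series is known to represent `h` only for small `t`, with a bound
  -- depending on `y`; the identity theorem on `S` carries the equality to `t = 1`.
  have heq := hψ.eqOn_of_preconnected_of_eventuallyEq hφ hS h0S (by
    have hSn : S ∈ 𝓝 (0 : ℝ) := by
      refine IsOpen.mem_nhds ?_ h0S
      exact isOpen_lt (by fun_prop) continuous_const
    filter_upwards [hasSum_dirTaylor (hln0 y 0 (by simpa using hδ)), hSn] with t ht htS
    have hcoef : (fun n => q n fun _ => t • y) = fun n => t ^ n * dirTaylor h n y := by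
      ext n
      rw [← dirTaylor_smul, ← hpd]
    have hsum := q.hasSum (hmem _ htS)
    rw [hcoef] at hsum
    exact hsum.unique ht)
  simpa using heq h1S

end Banach

/-! ### Cauchy estimates for compositions. -/

/-- Cauchy estimate for an absolutely convergent sum of monomials. -/
theorem abs_iteratedDeriv_le_of_hasSum_monomials {I : Type*} {a : I → ℝ} {w : I → ℕ} {F : ℝ → ℝ}
    {R B : ℝ} (hR : 0 < R) (hB : HasSum (fun i => |a i| * R ^ w i) B)
    (hF : ∀ s, |s| ≤ R → HasSum (fun i => a i * s ^ w i) (F s)) (l : ℕ) :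
    |iteratedDeriv l F 0| ≤ B / R ^ l * l.factorial := by
  -- Collecting the monomials of exponent `n` gives the power series coefficients of `F`, by
  -- uniqueness of the expansion.
  let b : ℕ → ℝ := fun n => ∑' i : {i // w i = n}, a i
  have hb : ∀ n, |b n| ≤ B / R ^ n := by
    intro n
    have hs : Summable fun i : {i // w i = n} => |a i| * R ^ n := by
      have := hB.summable.subtype {i | w i = n}
      refine this.congr fun i => ?_
      have hi : w i.1 = n := i.2
      simp only [Function.comp_apply, hi]
    have hs' : Summable fun i : {i // w i = n} => ‖a i‖ := by
      refine (hs.mul_right (R ^ n)⁻¹).congr fun i => ?_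
      rw [mul_assoc, mul_inv_cancel₀ (pow_pos hR n).ne', mul_one, Real.norm_eq_abs]
    rw [le_div_iff₀ (pow_pos hR n)]
    calc |b n| * R ^ n ≤ (∑' i : {i // w i = n}, |a i|) * R ^ n := by
          gcongr
          exact norm_tsum_le_tsum_norm hs'
      _ = ∑' i : {i // w i = n}, |a i| * R ^ w i := by
          rw [← tsum_mul_right]
          exact tsum_congr fun i => by rw [i.2]
      _ ≤ ∑' i, |a i| * R ^ w i :=
          Summable.tsum_subtype_le _ {i | w i = n} (fun i => by positivity) hB.summable
      _ = B := hB.tsum_eq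
  have hsum : ∀ s, |s| ≤ R → HasSum (fun n => s ^ n * b n) (F s) := by
    intro s hs
    have h1 := (Equiv.sigmaFiberEquiv w).hasSum_iff.2 (hF s hs)
    refine (h1.sigma fun n => (h1.summable.sigma_factor n).hasSum).congr_fun ?_
    intro n
    simp only [b, ← tsum_mul_left]
    refine tsum_congr fun i => ?_
    simp only [Function.comp_apply, Equiv.sigmaFiberEquiv_apply]
    rw [i.2, mul_comm]
  have hp : HasFPowerSeriesAt F (FormalMultilinearSeries.ofScalars ℝ b) 0 := by
    rw [hasFPowerSeriesAt_iff]
    filter_upwards [Metric.ball_mem_nhds (0 : ℝ) hR] with s hs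
    rw [Metric.mem_ball, dist_zero_right, Real.norm_eq_abs] at hs
    simpa only [FormalMultilinearSeries.coeff_ofScalars, smul_eq_mul, zero_add] using hsum s hs.le
  have heq := hp.eq_formalMultilinearSeries hp.analyticAt.hasFPowerSeriesAt
  have hl : b l = iteratedDeriv l F 0 / l.factorial := by
    have := congrArg (fun p => FormalMultilinearSeries.coeff p l) heq
    simpa only [FormalMultilinearSeries.coeff_ofScalars] using this
  have hl' := hb l
  rwa [hl, abs_div, Nat.abs_cast, div_le_iff₀ (by positivity)] at hl'

section Composition

variable {X : Type*} [NormedAddCommGroup X] [NormedSpace ℝ X]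

/-- Multilinear expansion of each `p k` at the polynomial `∑ s ^ i • c i` yields monomials in `s`.
Their absolute values at `R` are majorized by the `k`-th term of the scalar series, which justifies
the rearrangement. -/
theorem hasSum_comp_polynomial {h : X → ℝ} {p : FormalMultilinearSeries ℝ X ℝ} {r : ENNReal}
    (hp : HasFPowerSeriesOnBall h p 0 r) {l : ℕ} (c : Fin (l + 1) → X) {R : ℝ} (hR : 0 ≤ R)
    (hr : ENNReal.ofReal (∑ i : Fin (l + 1), ‖c i‖ * R ^ (i : ℕ)) < r)
    (hs : Summable fun k => ‖p k‖ * (∑ i : Fin (l + 1), ‖c i‖ * R ^ (i : ℕ)) ^ k) :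
    (∃ B ≤ ∑' k, ‖p k‖ * (∑ i : Fin (l + 1), ‖c i‖ * R ^ (i : ℕ)) ^ k,
      HasSum (fun x : Σ k : ℕ, Fin k → Fin (l + 1) =>
        |p x.1 fun i => c (x.2 i)| * R ^ (∑ i : Fin x.1, (x.2 i : ℕ))) B) ∧
    ∀ s : ℝ, |s| ≤ R → HasSum (fun x : Σ k : ℕ, Fin k → Fin (l + 1) =>
        (p x.1 fun i => c (x.2 i)) * s ^ (∑ i : Fin x.1, (x.2 i : ℕ)))
        (h (∑ i : Fin (l + 1), s ^ (i : ℕ) • c i)) := by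
  have hk : ∀ k, ∑ m : Fin k → Fin (l + 1), |p k fun i => c (m i)| * R ^ (∑ i : Fin k, (m i : ℕ)) ≤
      ‖p k‖ * (∑ i : Fin (l + 1), ‖c i‖ * R ^ (i : ℕ)) ^ k := by
    intro k
    rw [Fintype.sum_pow, Finset.mul_sum]
    refine Finset.sum_le_sum fun m _ => ?_
    rw [Finset.prod_mul_distrib, Finset.prod_pow_eq_pow_sum, ← mul_assoc]
    gcongr
    exact (p k).le_opNorm _
  have hsum : Summable fun x : Σ k : ℕ, Fin k → Fin (l + 1) =>
      |p x.1 fun i => c (x.2 i)| * R ^ (∑ i : Fin x.1, (x.2 i : ℕ)) := by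
    rw [summable_sigma_of_nonneg fun x => by positivity]
    refine ⟨fun k => (hasSum_fintype _).summable, ?_⟩
    refine Summable.of_nonneg_of_le (fun k => tsum_nonneg fun m => by positivity) (fun k => ?_) hs
    rw [tsum_fintype]
    exact hk k
  refine ⟨⟨_, ?_, hsum.hasSum⟩, fun s hsR => ?_⟩
  · rw [hsum.tsum_sigma]
    refine Summable.tsum_le_tsum (fun k => ?_) hsum.sigma hs
    rw [tsum_fintype]
    exact hk k
  · have hsum' : Summable fun x : Σ k : ℕ, Fin k → Fin (l + 1) =>
        (p x.1 fun i => c (x.2 i)) * s ^ (∑ i : Fin x.1, (x.2 i : ℕ)) := by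
      refine Summable.of_norm_bounded hsum fun x => ?_
      rw [Real.norm_eq_abs, abs_mul, abs_pow]
      gcongr
    have h1 : ∀ k, p k (fun _ => ∑ i : Fin (l + 1), s ^ (i : ℕ) • c i) =
        ∑ m : Fin k → Fin (l + 1), (p k fun i => c (m i)) * s ^ (∑ i : Fin k, (m i : ℕ)) := by
      intro k
      rw [(p k).map_sum]
      refine Finset.sum_congr rfl fun m _ => ?_
      rw [(p k).map_smul_univ (fun i => s ^ (m i : ℕ)) fun i => c (m i), smul_eq_mul,
        Finset.prod_pow_eq_pow_sum, mul_comm]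
    have h2 := hp.hasSum (y := ∑ i : Fin (l + 1), s ^ (i : ℕ) • c i) (by
      rw [Metric.mem_eball, edist_zero_right, ← ofReal_norm]
      refine (ENNReal.ofReal_le_ofReal ?_).trans_lt hr
      refine norm_sum_le_of_le _ fun i _ => ?_
      rw [norm_smul, norm_pow, Real.norm_eq_abs, mul_comm]
      gcongr)
    rw [zero_add] at h2
    have h3 := hsum'.hasSum.sigma fun k => hasSum_fintype _
    simp only [← h1] at h3
    rw [← h3.unique h2]
    exact hsum'.hasSum

/-- Derivative estimates for `h ∘ γ`, where `h` is analytic at `0` and `γ` has Taylor expansions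
with coefficients `c a n` bounded by `M n ^ n`. -/
theorem exists_bound_iteratedDeriv_comp {h : X → ℝ} (hh : AnalyticAt ℝ h 0) {γ : ℝ → X}
    {g : ℝ → ℝ} {c : ℝ → ℕ → X} {M : ℕ → ℝ} (hM : Monotone M) (hM1 : ∀ n, 1 ≤ M n) (hγ0 : γ 0 = 0)
    (hc0 : ∀ a, c a 0 = γ a) (hc : ∀ a, |a| ≤ 1 → ∀ n, 1 ≤ n → ‖c a n‖ ≤ M n ^ n)
    (hrem : ∀ a s : ℝ, |a| ≤ 1 → |s| ≤ 1 → ∀ l : ℕ,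
      ‖γ (a + s) - ∑ n ∈ Finset.range (l + 1), s ^ n • c a n‖ ≤ (M (l + 1) * |s|) ^ (l + 1))
    (hsm : ContDiff ℝ ∞ g) (hgγ : ∀ t, |t| ≤ 2 → h (γ t) = g t) :
    ∃ η > 0, ∃ K C : ℝ, 0 ≤ K ∧ 0 ≤ C ∧ ∀ a, |a| < η → ∀ l : ℕ,
      |iteratedDeriv l g a| ≤ K * (C * M l) ^ l * l.factorial := by
  obtain ⟨p, r, hp⟩ := hh
  obtain ⟨K, r₀, hK, hr₀, hpb⟩ :=
    p.le_mul_pow_of_radius_pos (hp.r_pos.trans_le hp.r_le)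
  obtain ⟨r', hr', hr'r⟩ : ∃ r' : ℝ, 0 < r' ∧ ENNReal.ofReal r' < r := by
    obtain ⟨r', h1, h2⟩ := ENNReal.lt_iff_exists_nnreal_btwn.1 hp.r_pos
    exact ⟨r', by exact_mod_cast h1, by rwa [ENNReal.ofReal_coe_nnreal]⟩
  obtain ⟨ε, hε, hεr', hεr₀⟩ : ∃ ε : ℝ, 0 < ε ∧ 2 * ε ≤ r' ∧ r₀ * (2 * ε) ≤ 1 / 2 := by
    refine ⟨min (r' / 2) (1 / (4 * r₀)), by positivity, ?_, ?_⟩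
    · linarith [min_le_left (r' / 2) (1 / (4 * r₀))]
    · calc r₀ * (2 * min (r' / 2) (1 / (4 * r₀))) ≤ r₀ * (2 * (1 / (4 * r₀))) := by
            gcongr
            exact min_le_right _ _
        _ = 1 / 2 := by field_simp; norm_num
  have hMpos : ∀ n, 0 < M n := fun n => one_pos.trans_le (hM1 n)
  -- This makes the geometric sum `∑_{n ≥ 1} N ^ (-n) = 1 / (N - 1)` equal to `ε`.
  set N : ℝ := 1 + 1 / ε
  have hN : 0 < N := by positivity
  refine ⟨min 1 (ε / M 1), lt_min one_pos (div_pos hε (hMpos 1)), 2 * K, N, by positivity, hN.le,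
    fun a ha l => ?_⟩
  have ha1 : |a| ≤ 1 := (ha.trans_le (min_le_left _ _)).le
  have hγa : ‖γ a‖ ≤ ε := by
    have h1 := hrem 0 a (by simp) ha1 0
    simp only [zero_add, Finset.range_one, Finset.sum_singleton, pow_zero, one_smul, hc0, hγ0,
      sub_zero, pow_one] at h1
    have h2 := (ha.trans_le (min_le_right _ _)).le
    rw [le_div_iff₀ (hMpos 1), mul_comm] at h2
    exact h1.trans h2
  -- The radius depends on the order `l`: since `M n ≤ M l` for `n ≤ l`, the Taylor polynomial of
  -- degree `l` has terms of norm at most `N ^ (-n)` for `n ≥ 1` at this radius.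
  set R : ℝ := 1 / (N * M l)
  have hR : 0 < R := one_div_pos.2 (mul_pos hN (hMpos l))
  set d : Fin (l + 1) → X := fun i => c a i
  have hd : ∑ i, ‖d i‖ * R ^ (i : ℕ) ≤ 2 * ε := by
    rw [Fin.sum_univ_eq_sum_range (fun n => ‖c a n‖ * R ^ n), Finset.sum_range_succ', hc0, pow_zero,
      mul_one]
    have hle : ∀ n ∈ Finset.range l, ‖c a (n + 1)‖ * R ^ (n + 1) ≤ (1 / N) * (1 / N) ^ n := by
      intro n hn
      have hn : n + 1 ≤ l := Finset.mem_range.1 hn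
      calc ‖c a (n + 1)‖ * R ^ (n + 1) ≤ M l ^ (n + 1) * R ^ (n + 1) := by
            gcongr
            refine (hc a ha1 (n + 1) (by omega)).trans ?_
            have := (hMpos (n + 1)).le
            gcongr
            exact hM hn
        _ = (1 / N) ^ (n + 1) := by
            rw [← mul_pow]
            congr 1
            have := (hMpos l).ne'
            simp only [R]
            field_simp
        _ = _ := by ring
    have hN1 : 1 / N < 1 := by
      rw [div_lt_one hN]
      have : 0 < 1 / ε := by positivity
      linarith
    have hgeo : ∑ n ∈ Finset.range l, (1 / N) * (1 / N) ^ n ≤ ε := by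
      have h1 := (hasSum_geometric_of_lt_one (by positivity) hN1).mul_left (1 / N)
      have h2 := sum_le_hasSum (Finset.range l) (fun n _ => by positivity) h1
      refine h2.trans (le_of_eq ?_)
      have h3 : N - 1 = 1 / ε := by simp [N]
      have h4 : (1 : ℝ) - 1 / N = (N - 1) / N := by field_simp
      rw [h4, h3]
      field_simp
    linarith [Finset.sum_le_sum hle]
  have hd0 : 0 ≤ ∑ i, ‖d i‖ * R ^ (i : ℕ) := Finset.sum_nonneg fun i _ => by positivity
  have hle : ∀ k, ‖p k‖ * (∑ i, ‖d i‖ * R ^ (i : ℕ)) ^ k ≤ K * (1 / 2) ^ k := by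
    intro k
    calc ‖p k‖ * (∑ i, ‖d i‖ * R ^ (i : ℕ)) ^ k ≤ (K * r₀ ^ k) * (2 * ε) ^ k := by
          gcongr
          exact hpb k
      _ = K * (r₀ * (2 * ε)) ^ k := by rw [mul_pow]; ring
      _ ≤ _ := by gcongr
  have hgeo : HasSum (fun k : ℕ => K * (1 / 2 : ℝ) ^ k) (K * 2) := hasSum_geometric_two.mul_left K
  have hsummable : Summable fun k => ‖p k‖ * (∑ i, ‖d i‖ * R ^ (i : ℕ)) ^ k :=
    Summable.of_nonneg_of_le (fun k => by positivity) hle hgeo.summable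
  obtain ⟨⟨B, hB, hBsum⟩, hFsum⟩ := hasSum_comp_polynomial hp d hR.le
    ((ENNReal.ofReal_le_ofReal (hd.trans hεr')).trans_lt hr'r) hsummable
  have hB2 : B ≤ 2 * K := by
    refine hB.trans ?_
    rw [mul_comm, ← hgeo.tsum_eq]
    exact hsummable.tsum_le_tsum hle hgeo.summable
  have hest := abs_iteratedDeriv_le_of_hasSum_monomials hR hBsum hFsum l
  have hball : γ a ∈ Metric.eball (0 : X) r := by
    rw [Metric.mem_eball, edist_zero_right, ← ofReal_norm]
    refine (ENNReal.ofReal_le_ofReal ?_).trans_lt hr'r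
    linarith
  have hha : AnalyticAt ℝ h (γ a) := hp.analyticOnNhd _ hball
  set q : ℝ → X := fun s => ∑ i : Fin (l + 1), s ^ (i : ℕ) • d i
  have hq0 : q 0 = γ a := by
    simp only [q]
    rw [Fin.sum_univ_succ]
    simp [d, hc0]
  have hqan : AnalyticAt ℝ q 0 := by
    refine Finset.analyticAt_fun_sum _ fun i _ => ?_
    exact (analyticAt_id.pow _).smul analyticAt_const
  have hqe : ∀ s, q s = ∑ n ∈ Finset.range (l + 1), s ^ n • c a n := fun s =>
    Fin.sum_univ_eq_sum_range (fun n => s ^ n • c a n) (l + 1)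
  have hsmall : ∀ᶠ s : ℝ in 𝓝 0, |s| ≤ 1 := by
    filter_upwards [Metric.closedBall_mem_nhds (0 : ℝ) one_pos] with s hs
    simpa using hs
  have hγcont : Tendsto (fun s => γ (a + s)) (𝓝 0) (𝓝 (γ a)) := by
    rw [tendsto_iff_norm_sub_tendsto_zero]
    have hz : Tendsto (fun s : ℝ => M 1 * |s|) (𝓝 0) (𝓝 0) := by
      have : Tendsto (fun s : ℝ => M 1 * |s|) (𝓝 0) (𝓝 (M 1 * |0|)) :=
        (continuous_const.mul continuous_abs).tendsto 0
      rwa [abs_zero, mul_zero] at this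
    refine squeeze_zero' (Eventually.of_forall fun _ => norm_nonneg _) ?_ hz
    filter_upwards [hsmall] with s hs
    simpa [hc0] using hrem a s ha1 hs 0
  have hqcont : Tendsto q (𝓝 0) (𝓝 (γ a)) := by
    rw [← hq0]
    exact hqan.continuousAt
  -- `h` is Lipschitz near `γ a`, so replacing `γ` by its Taylor polynomial `q` changes the
  -- composite only by `O(s ^ (l + 1))`, leaving the `l`-th derivative intact.
  have hdiff : (fun s => g (a + s) - h (q s)) =O[𝓝 0] fun s => (s - 0) ^ (l + 1) := by
    have h1 := (hha.hasStrictFDerivAt.isBigO_sub).comp_tendsto (hγcont.prodMk_nhds hqcont)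
    have h0 : (fun s => g (a + s) - h (q s)) =ᶠ[𝓝 0] fun s => h (γ (a + s)) - h (q s) := by
      filter_upwards [hsmall] with s hs
      rw [hgγ _ (by linarith [abs_add_le a s])]
    refine h0.trans_isBigO (h1.trans (Asymptotics.IsBigO.of_bound (M (l + 1) ^ (l + 1)) ?_))
    filter_upwards [hsmall] with s hs
    have h2 := hrem a s ha1 hs l
    rw [← hqe, mul_pow] at h2
    rw [norm_pow, sub_zero, Real.norm_eq_abs]
    exact h2
  have hcd1 : ContDiffAt ℝ ∞ (fun s => g (a + s)) 0 :=
    (hsm.comp (contDiff_const.add contDiff_id)).contDiffAt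
  have hcd2 : ContDiffAt ℝ ∞ (fun s => h (q s)) 0 :=
    (AnalyticAt.comp_of_eq hha hqan hq0).contDiffAt
  have hzero := iteratedDeriv_eq_zero_of_isBigO (n := l)
    ((hcd1.sub hcd2).of_le (by exact_mod_cast le_top)) hdiff l le_rfl
  rw [iteratedDeriv_fun_sub (hcd1.of_le (by exact_mod_cast le_top))
    (hcd2.of_le (by exact_mod_cast le_top)), iteratedDeriv_comp_const_add] at hzero
  simp only [add_zero, sub_eq_zero] at hzero
  rw [hzero]
  refine hest.trans ?_
  gcongr
  rw [div_eq_mul_inv]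
  have : (R ^ l)⁻¹ = (N * M l) ^ l := by
    rw [← inv_pow]
    simp [R]
  rw [this]
  have := (hMpos l).le
  gcongr

end Composition

/-- Local Cauchy estimates for real analytic functions of one variable. -/
theorem AnalyticOnNhd.exists_bound_iteratedDeriv {g : ℝ → ℝ} (hg : AnalyticOnNhd ℝ g Set.univ)
    {S : Set ℝ} (hS : IsCompact S) :
    ∃ K C : ℝ, 0 ≤ K ∧ 0 ≤ C ∧ ∀ t ∈ S, ∀ n : ℕ,
      |iteratedDeriv n g t| ≤ K * C ^ n * n.factorial := by
  refine hS.induction_on (p := fun S => ∃ K C : ℝ, 0 ≤ K ∧ 0 ≤ C ∧ ∀ t ∈ S, ∀ n : ℕ,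
      |iteratedDeriv n g t| ≤ K * C ^ n * n.factorial) ⟨0, 0, le_rfl, le_rfl, by simp⟩ ?_ ?_ ?_
  · rintro S T hST ⟨K, C, hK, hC, h⟩
    exact ⟨K, C, hK, hC, fun t ht => h t (hST ht)⟩
  · rintro S T ⟨K, C, hK, hC, h⟩ ⟨K', C', hK', hC', h'⟩
    refine ⟨max K K', max C C', le_max_of_le_left hK, le_max_of_le_left hC, ?_⟩
    rintro t (ht | ht) n
    · refine (h t ht n).trans ?_
      gcongr
      · exact le_max_left _ _
      · exact le_max_left _ _
    · refine (h' t ht n).trans ?_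
      gcongr
      · exact le_max_right _ _
      · exact le_max_right _ _
  · intro x _
    have hgx : AnalyticAt ℝ (fun t => g (x + t)) 0 :=
      AnalyticAt.comp_of_eq (hg x trivial) (analyticAt_const.add analyticAt_id) (by simp)
    have hgs : ContDiff ℝ ∞ fun t => g (x + t) := by
      refine contDiff_iff_contDiffAt.2 fun t => ?_
      exact (AnalyticAt.comp_of_eq (hg (x + t) trivial) (analyticAt_const.add analyticAt_id)
        (by simp)).contDiffAt
    -- The composition estimate for the identity curve, with Taylor coefficients `a, 1, 0, …` and `M
    -- = 1`.
    obtain ⟨η, hη, K, C, hK, hC, h⟩ := exists_bound_iteratedDeriv_comp (γ := fun t => t)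
      (c := fun a n => if n = 0 then a else if n = 1 then 1 else 0) (M := fun _ => 1) hgx
      monotone_const (fun _ => le_rfl) rfl (fun a => by simp) (fun a _ n hn => by
        rcases eq_or_ne n 1 with rfl | h1
        · simp
        · simp [h1, show n ≠ 0 by omega]) (fun a s _ hs l => by
        rcases l with _ | l
        · simp
        · have : ∑ n ∈ Finset.range (l + 1 + 1), s ^ n • (if n = 0 then a else if n = 1 then 1
              else 0 : ℝ) = a + s := by
            rw [Finset.sum_range_succ', Finset.sum_range_succ']
            simp [add_comm]
          rw [this]
          simp only [sub_self, norm_zero, one_mul]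
          positivity) hgs fun _ _ => rfl
    refine ⟨Metric.ball x η, mem_nhdsWithin_of_mem_nhds (Metric.ball_mem_nhds x hη), K, C, hK, hC,
      fun t ht n => ?_⟩
    have h1 := h (t - x) (by simpa [Metric.mem_ball, Real.dist_eq] using ht) n
    rw [iteratedDeriv_comp_const_add n g] at h1
    simpa using h1

-- Banach spaces inside a complete dual pair, and derivatives of smooth curves.

universe u

namespace DualPair

variable {E F : Type*} [AddCommGroup E] [Module ℝ E] [AddCommGroup F] [Module ℝ F]

theorem absorbent_preimage_span {A : Set E} (hA : AbsConvex ℝ A) (h0 : (0 : E) ∈ A) :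
    Absorbent ℝ (((↑) : Submodule.span ℝ A → E) ⁻¹' A) := by
  have key : ∀ x ∈ Submodule.span ℝ A, ∃ r : ℝ, 0 < r ∧ r • x ∈ A := by
    intro x hx
    induction hx using Submodule.span_induction with
    | mem x hx => exact ⟨1, one_pos, by rwa [one_smul]⟩
    | zero => exact ⟨1, one_pos, by rwa [smul_zero]⟩
    | add x y _ _ hx hy =>
      obtain ⟨r, hr, hrx⟩ := hx
      obtain ⟨s, hs, hsy⟩ := hy
      refine ⟨r * s / (r + s), by positivity, ?_⟩
      have : (s / (r + s)) • r • x + (r / (r + s)) • s • y ∈ A :=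
        hA.2 hrx hsy (by positivity) (by positivity) (by field_simp; ring)
      rw [smul_smul, smul_smul] at this
      rw [smul_add]
      convert this using 3 <;> ring
    | smul c x _ hx =>
      obtain ⟨r, hr, hrx⟩ := hx
      refine ⟨r / (|c| + 1), by positivity, ?_⟩
      have h1 : ‖c / (|c| + 1)‖ ≤ 1 := by
        rw [norm_div, Real.norm_eq_abs, Real.norm_of_nonneg (by positivity),
          div_le_one (by positivity)]
        linarith
      have := hA.1.smul_mem h1 hrx
      rw [smul_smul] at this ⊢
      convert this using 2
      ring
  rw [absorbent_iff_eventually_nhdsNE_zero]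
  rintro ⟨x, hx⟩
  obtain ⟨r, hr, hrx⟩ := key x hx
  filter_upwards [nhdsWithin_le_nhds (Metric.ball_mem_nhds (0 : ℝ) hr)] with c hc
  rw [Metric.mem_ball, dist_zero_right] at hc
  have h1 : ‖c / r‖ ≤ 1 := by
    rw [norm_div, Real.norm_of_nonneg hr.le, div_le_one hr]
    exact hc.le
  have := hA.1.smul_mem h1 hrx
  rwa [smul_smul, div_mul_cancel₀ _ hr.ne'] at this

theorem gauge_preimage_span (A : Set E) (x : Submodule.span ℝ A) :
    gauge (((↑) : Submodule.span ℝ A → E) ⁻¹' A) x = gauge A (x : E) := by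
  rw [gauge_def', gauge_def']
  rfl

/-- In a complete dual pair, every bounded set is contained in the image of the unit ball of a
Banach space under an injective bounded linear map. -/
theorem IsComplete.exists_banach {E : Type u} [AddCommGroup E] [Module ℝ E] {P : DualPair E}
    (hP : P.IsComplete) {B : Set E} (hB : P.IsBounded B) :
    ∃ (X : Type u) (_ : NormedAddCommGroup X) (_ : NormedSpace ℝ X) (_ : CompleteSpace X)
      (i : X →ₗ[ℝ] E), Function.Injective i ∧ (∀ b ∈ B, ∃ x, ‖x‖ ≤ 1 ∧ i x = b) ∧
        ∀ l ∈ P.dual, Continuous fun x => l (i x) := by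
  -- Adjoining `0` forces `0 ∈ A`, even for empty `B`; the absorbency argument needs this.
  have hB0 : P.IsBounded (insert 0 B) := fun l hl => by
    rw [Set.image_insert_eq, Bornology.isBounded_insert]
    exact hB l hl
  obtain ⟨A, hBA, hAb, hAc, hAs⟩ := hP _ hB0
  have h0 : (0 : E) ∈ A := hBA (Set.mem_insert _ _)
  set S := Submodule.span ℝ A
  set A' : Set S := ((↑) : S → E) ⁻¹' A
  have habs : Absorbent ℝ A' := absorbent_preimage_span hAc h0
  have hbal : Balanced ℝ A' := by
    intro c hc
    rintro _ ⟨x, hx, rfl⟩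
    exact hAc.1.smul_mem hc hx
  have hconv : Convex ℝ A' := hAc.2.linear_preimage S.subtype
  have hbound : ∀ l ∈ P.dual, ∃ C : ℝ, 0 ≤ C ∧ ∀ x : S, |l x| ≤ C * gauge A' x := by
    intro l hl
    obtain ⟨C, hC⟩ := isBounded_iff_forall_norm_le.1 (hAb l hl)
    have hC0 : 0 ≤ C := (norm_nonneg _).trans (hC _ ⟨0, h0, rfl⟩)
    refine ⟨C, hC0, fun x => ?_⟩
    have h1 : ∀ a, gauge A' x < a → |l x| ≤ C * a := by
      intro a ha
      obtain ⟨b, hb, hba, hx⟩ := exists_lt_of_gauge_lt habs ha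
      obtain ⟨y, hy, rfl⟩ := hx
      have := hC _ ⟨y, hy, rfl⟩
      rw [Real.norm_eq_abs] at this
      change |l (b • (y : E))| ≤ _
      rw [map_smul, smul_eq_mul, abs_mul, abs_of_pos hb, mul_comm]
      gcongr
    have hlim : Tendsto (fun a => C * a) (𝓝[>] (gauge A' x)) (𝓝 (C * gauge A' x)) :=
      ((continuous_const.mul continuous_id).tendsto _).mono_left nhdsWithin_le_nhds
    exact ge_of_tendsto hlim (by filter_upwards [self_mem_nhdsWithin] with a ha using h1 a ha)
  let : Norm S := ⟨gauge A'⟩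
  have core : NormedSpace.Core ℝ S :=
    { norm_nonneg := fun x => gauge_nonneg x
      norm_smul := fun c x => gauge_smul hbal c x
      norm_triangle := fun x y => gauge_add_le hconv habs x y
      norm_eq_zero_iff := fun x => by
        refine ⟨fun hx => ?_, fun hx => by rw [hx]; exact gauge_zero⟩
        have hx : gauge A' x = 0 := hx
        refine Subtype.ext (P.separating x fun l hl => ?_)
        obtain ⟨C, -, hC⟩ := hbound l hl
        have := hC x
        rw [hx, mul_zero] at this
        exact abs_nonpos_iff.1 this }
  let : NormedAddCommGroup S := NormedAddCommGroup.ofCore core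
  let : NormedSpace ℝ S := NormedSpace.ofCore core
  have hnorm : ∀ x : S, ‖x‖ = gauge A (x : E) := gauge_preimage_span A
  refine ⟨S, inferInstance, inferInstance, ?_, S.subtype, S.injective_subtype, fun b hb => ?_,
    fun l hl => ?_⟩
  · refine Metric.complete_of_cauchySeq_tendsto fun u hu => ?_
    obtain ⟨x, hx, hlim⟩ := hAs (fun n => u n) (fun n => (u n).2) fun ε hε => by
      obtain ⟨N, hN⟩ := Metric.cauchySeq_iff.1 hu ε hε
      refine ⟨N, fun m hm n hn => ?_⟩
      have := hN m hm n hn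
      rwa [dist_eq_norm, hnorm] at this
    refine ⟨⟨x, hx⟩, ?_⟩
    rw [tendsto_iff_norm_sub_tendsto_zero]
    exact hlim.congr fun n => (hnorm (u n - ⟨x, hx⟩)).symm
  · have hbA := hBA (Set.mem_insert_of_mem _ hb)
    exact ⟨⟨b, Submodule.subset_span hbA⟩, (hnorm _).trans_le (gauge_le_one_of_mem hbA), rfl⟩
  · obtain ⟨C, -, hC⟩ := hbound l hl
    exact AddMonoidHomClass.continuous_of_bound (l.comp S.subtype) C hC

/-- Smooth curves in a complete dual pair are differentiable. -/
theorem IsComplete.exists_deriv {P : DualPair E} (hP : P.IsComplete) {c : ℝ → E}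
    (hc : P.SmoothCurve c) (t : ℝ) : ∃ d : E, ∀ l ∈ P.dual, l d = deriv (fun s => l (c s)) t := by
  let D : ℕ → E := fun n => ((n : ℝ) + 1) • (c (t + 1 / ((n : ℝ) + 1)) - c t)
  have hD : ∀ l ∈ P.dual, ∃ C : ℝ, 0 ≤ C ∧ ∀ n : ℕ,
      |l (D n) - deriv (fun s => l (c s)) t| ≤ C / ((n : ℝ) + 1) := by
    intro l hl
    have hg := hc l hl
    obtain ⟨C, hC⟩ := (isCompact_Icc (a := t) (b := t + 1)).exists_bound_of_continuousOn
      ((contDiff_infty.1 hg 2).continuous_iteratedDeriv 2 le_rfl).continuousOn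
    have hC0 : 0 ≤ C := (norm_nonneg _).trans (hC t (by simp))
    refine ⟨C, hC0, fun n => ?_⟩
    have hn : (0 : ℝ) < (n : ℝ) + 1 := by positivity
    have hn1 : 1 / ((n : ℝ) + 1) ≤ 1 := by
      rw [div_le_one hn]
      have : (0 : ℝ) ≤ n := Nat.cast_nonneg n
      linarith
    have h1 := abs_sub_taylor_le (n := 1) (x₀ := t) (x := t + 1 / ((n : ℝ) + 1)) (C := C)
      (fun s _ => by exact_mod_cast (contDiff_infty.1 hg 2).contDiffAt) fun s hs => by
        rw [Set.uIcc_of_le (by linarith [one_div_pos.2 hn])] at hs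
        exact hC s ⟨hs.1, by linarith [hs.2]⟩
    simp only [Finset.sum_range_succ, Finset.range_zero, Finset.sum_empty, iteratedDeriv_zero,
      iteratedDeriv_one, add_sub_cancel_left, pow_zero, pow_one, Nat.factorial, Nat.cast_one,
      div_one, mul_one, zero_add] at h1
    have h2 : l (D n) - deriv (fun s => l (c s)) t = ((n : ℝ) + 1) *
        (l (c (t + 1 / ((n : ℝ) + 1))) - (l (c t) + deriv (fun s => l (c s)) t *
          (1 / ((n : ℝ) + 1)))) := by
      simp only [D, map_smul, map_sub, smul_eq_mul]
      field_simp
      ring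
    rw [h2, abs_mul, abs_of_pos hn]
    calc ((n : ℝ) + 1) * _ ≤ ((n : ℝ) + 1) * (C * (1 / ((n : ℝ) + 1)) ^ 2) := by
          refine mul_le_mul_of_nonneg_left (h1.trans ?_) hn.le
          rw [abs_of_pos (one_div_pos.2 hn)]
          refine (div_le_self (by positivity) ?_)
          norm_num
      _ = C / ((n : ℝ) + 1) := by field_simp
  -- The difference quotients converge at rate `1 / (n + 1)` under every functional, so their scaled
  -- differences stay bounded. In the Banach space generated by `B` this makes the quotients a
  -- Cauchy sequence.
  let B : Set E := Set.range D ∪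
    {e | ∃ N m n : ℕ, N ≤ m ∧ N ≤ n ∧ e = ((N : ℝ) + 1) • (D m - D n)}
  have hB : P.IsBounded B := by
    intro l hl
    obtain ⟨C, hC0, hC⟩ := hD l hl
    refine isBounded_iff_forall_norm_le.2 ⟨2 * C + |deriv (fun s => l (c s)) t|, ?_⟩
    rintro _ ⟨e, (⟨n, rfl⟩ | ⟨N, m, n, hm, hn, rfl⟩), rfl⟩
    · rw [Real.norm_eq_abs]
      have h1 : C / ((n : ℝ) + 1) ≤ C := div_le_self hC0 (by
        have : (0 : ℝ) ≤ n := Nat.cast_nonneg n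
        linarith)
      have h2 := abs_sub_abs_le_abs_sub (l (D n)) (deriv (fun s => l (c s)) t)
      linarith [hC n]
    · have hN : (0 : ℝ) < (N : ℝ) + 1 := by positivity
      have hle : ∀ k : ℕ, N ≤ k → C / ((k : ℝ) + 1) ≤ C / ((N : ℝ) + 1) := fun k hk => by
        gcongr
      have h1 := abs_sub_le (l (D m)) (deriv (fun s => l (c s)) t) (l (D n))
      rw [abs_sub_comm (deriv _ t) (l (D n))] at h1
      have h2 : |l (D m) - l (D n)| ≤ 2 * C / ((N : ℝ) + 1) := by
        refine h1.trans (((add_le_add (hC m) (hC n)).trans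
          (add_le_add (hle m hm) (hle n hn))).trans_eq (by ring))
      rw [map_smul, map_sub, smul_eq_mul, Real.norm_eq_abs, abs_mul, abs_of_pos hN]
      calc ((N : ℝ) + 1) * |l (D m) - l (D n)| ≤ ((N : ℝ) + 1) * (2 * C / ((N : ℝ) + 1)) := by
            gcongr
        _ = 2 * C := by field_simp
        _ ≤ _ := le_add_of_nonneg_right (abs_nonneg _)
  obtain ⟨X, _, _, _, i, hi, hiB, hicont⟩ := hP.exists_banach hB
  choose d hd1 hd using fun n => hiB (D n) (Or.inl ⟨n, rfl⟩)
  have hcau : CauchySeq d := by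
    refine cauchySeq_of_le_tendsto_0 (fun N : ℕ => 1 / ((N : ℝ) + 1)) (fun n m N hn hm => ?_)
      tendsto_one_div_add_atTop_nhds_zero_nat
    obtain ⟨x, hx1, hx⟩ := hiB _ (Or.inr ⟨N, n, m, hn, hm, rfl⟩)
    have hN : (0 : ℝ) < (N : ℝ) + 1 := by positivity
    have hx' : x = ((N : ℝ) + 1) • (d n - d m) := hi (by rw [hx, map_smul, map_sub, hd, hd])
    rw [hx', norm_smul, Real.norm_of_nonneg hN.le] at hx1
    rw [dist_eq_norm, le_div_iff₀ hN, mul_comm]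
    exact hx1
  obtain ⟨x, hx⟩ := cauchySeq_tendsto_of_complete hcau
  refine ⟨i x, fun l hl => ?_⟩
  have h1 : Tendsto (fun n => l (D n)) atTop (𝓝 (l (i x))) := by
    have := ((hicont l hl).tendsto x).comp hx
    simpa only [Function.comp_def, hd] using this
  obtain ⟨C, -, hC⟩ := hD l hl
  refine tendsto_nhds_unique h1 ?_
  rw [tendsto_iff_norm_sub_tendsto_zero]
  refine squeeze_zero (fun _ => norm_nonneg _) hC ?_
  have := (tendsto_one_div_add_atTop_nhds_zero_nat (𝕜 := ℝ)).const_mul C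
  simpa only [mul_one_div, mul_zero] using this

theorem IsComplete.exists_iteratedDeriv {P : DualPair E} (hP : P.IsComplete) {c : ℝ → E}
    (hc : P.SmoothCurve c) (n : ℕ) :
    ∃ d : ℝ → E, ∀ l ∈ P.dual, ∀ t, l (d t) = iteratedDeriv n (fun s => l (c s)) t := by
  induction n with
  | zero => exact ⟨c, fun l _ t => by simp⟩
  | succ n ih =>
    obtain ⟨d, hd⟩ := ih
    have hds : P.SmoothCurve d := fun l hl => by
      rw [funext (hd l hl)]
      rw [iteratedDeriv_eq_iterate]
      exact (hc l hl).iterate_deriv n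
    choose d' hd' using hP.exists_deriv hds
    refine ⟨d', fun l hl t => ?_⟩
    rw [hd' t l hl, funext (hd l hl), iteratedDeriv_succ]

end DualPair

/-! ### Lifting analytic curves, and analyticity along them. -/

/-- If a smooth function is not analytic at `0`, then its normalized derivatives near `0` grow
faster than any geometric sequence along a subsequence of orders. -/
theorem exists_subsequence_of_not_analyticAt {g : ℝ → ℝ} (hg : ContDiff ℝ ∞ g)
    (hna : ¬AnalyticAt ℝ g 0) : ∃ L : ℕ → ℕ, StrictMono L ∧ ∀ j : ℕ, ∃ a : ℝ,
      |a| < 1 / ((j : ℝ) + 1) ∧ ((j : ℝ) + 1) * (((j : ℝ) + 1) ^ 2) ^ L j * (L j).factorial <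
        |iteratedDeriv (L j) g a| := by
  refine extraction_forall_of_frequently (P := fun j l => ∃ a : ℝ,
      |a| < 1 / ((j : ℝ) + 1) ∧ ((j : ℝ) + 1) * (((j : ℝ) + 1) ^ 2) ^ l * l.factorial <
        |iteratedDeriv l g a|) fun j => ?_
  rw [frequently_atTop]
  intro m
  have hj : (1 : ℝ) ≤ (j : ℝ) + 1 := by
    have : (0 : ℝ) ≤ j := Nat.cast_nonneg j
    linarith
  have hbd : ∀ n : ℕ, ∃ K, ∀ t ∈ Set.Icc (-1 : ℝ) 1, ‖iteratedDeriv n g t‖ ≤ K := fun n =>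
    isCompact_Icc.exists_bound_of_continuousOn
      (hg.continuous_iteratedDeriv n (by exact_mod_cast le_top)).continuousOn
  choose K hK using hbd
  have hK0 : ∀ n, 0 ≤ K n := fun n => (norm_nonneg _).trans (hK n 0 (by simp))
  -- The finitely many orders below `m` are absorbed into the constant; a bound for all orders `≥ m`
  -- would then contradict non-analyticity.
  set K' : ℝ := ((j : ℝ) + 1) + ∑ n ∈ Finset.range m, K n
  have hKj : (j : ℝ) + 1 ≤ K' := le_add_of_nonneg_right (Finset.sum_nonneg fun n _ => hK0 n)
  by_contra hcon
  push Not at hcon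
  refine hna (analyticAt_of_iteratedDeriv_bound (δ := 1 / ((j : ℝ) + 1)) (K := K')
    (C := ((j : ℝ) + 1) ^ 2) (by positivity) (fun t _ => hg.contDiffAt) fun t ht n => ?_)
  rw [Metric.mem_ball, dist_zero_right, Real.norm_eq_abs] at ht
  rcases lt_or_ge n m with hn | hn
  · have ht1 : |t| ≤ 1 := ht.le.trans ((div_le_one (by positivity)).2 hj)
    have h1 := hK n t (abs_le.1 ht1)
    rw [Real.norm_eq_abs] at h1
    have h2 : K n ≤ K' := by
      have := Finset.single_le_sum (f := K) (fun n _ => hK0 n) (Finset.mem_range.2 hn)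
      linarith
    have h3 : (1 : ℝ) ≤ (((j : ℝ) + 1) ^ 2) ^ n := one_le_pow₀ (one_le_pow₀ hj)
    have h4 : (1 : ℝ) ≤ n.factorial := by exact_mod_cast Nat.factorial_pos n
    have h5 : 0 ≤ K' := (hK0 n).trans h2
    calc |iteratedDeriv n g t| ≤ K' := h1.trans h2
      _ ≤ K' * (((j : ℝ) + 1) ^ 2) ^ n := le_mul_of_one_le_right h5 h3
      _ ≤ _ := le_mul_of_one_le_right (by positivity) h4
  · refine (hcon n hn t ht).trans ?_
    gcongr

namespace DualPair

variable {E : Type u} {F : Type*} [AddCommGroup E] [Module ℝ E] [AddCommGroup F] [Module ℝ F]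

theorem AnalyticCurve.smoothCurve {P : DualPair E} {c : ℝ → E} (hc : P.AnalyticCurve c) :
    P.SmoothCurve c := fun l hl =>
  contDiff_iff_contDiffAt.2 fun t => (hc l hl t trivial).contDiffAt

/-- An analytic curve with its Taylor expansions in a Banach space, with coefficients controlled
by a prescribed sequence `M n → ∞`. -/
theorem AnalyticCurve.exists_banach {P : DualPair E} (hP : P.IsComplete) {c : ℝ → E}
    (hc : P.AnalyticCurve c) {M : ℕ → ℝ} (hM1 : ∀ n, 1 ≤ M n) (hM : Tendsto M atTop atTop) :
    ∃ (X : Type u) (_ : NormedAddCommGroup X) (_ : NormedSpace ℝ X) (_ : CompleteSpace X)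
      (i : X →ₗ[ℝ] E) (γ : ℝ → X) (d : ℝ → ℕ → X), (∀ l ∈ P.dual, Continuous fun x => l (i x)) ∧
      (∀ t, |t| ≤ 2 → c 0 + i (γ t) = c t) ∧ γ 0 = 0 ∧ (∀ a, d a 0 = γ a) ∧
      (∀ a, |a| ≤ 1 → ∀ n, 1 ≤ n → ‖d a n‖ ≤ M n ^ n) ∧
      ∀ a s : ℝ, |a| ≤ 1 → |s| ≤ 1 → ∀ l : ℕ,
        ‖γ (a + s) - ∑ n ∈ Finset.range (l + 1), s ^ n • d a n‖ ≤
          (M (l + 1) * |s|) ^ (l + 1) := by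
  have hMpos : ∀ n, 0 < M n := fun n => one_pos.trans_le (hM1 n)
  choose D hD using hP.exists_iteratedDeriv hc.smoothCurve
  have hD0 : ∀ t, D 0 t = c t := fun t => by
    rw [← sub_eq_zero]
    refine P.separating _ fun l hl => ?_
    rw [map_sub, hD 0 l hl t, iteratedDeriv_zero, sub_self]
  let co : ℝ → ℕ → E := fun a n => (1 / (n.factorial : ℝ)) • D n a
  let rem : ℝ → ℝ → ℕ → E := fun a s l => c (a + s) - ∑ n ∈ Finset.range (l + 1), s ^ n • co a n
  let B : Set E := {e | ∃ (a : ℝ) (n : ℕ), |a| ≤ 1 ∧ e = (M n ^ n)⁻¹ • co a n} ∪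
    {e | ∃ (a s : ℝ) (l : ℕ), |a| ≤ 1 ∧ |s| ≤ 1 ∧ e = ((M (l + 1) * |s|) ^ (l + 1))⁻¹ • rem a s l}
  have hB : P.IsBounded B := by
    intro l hl
    obtain ⟨K, C, hK, hC, hb⟩ := (hc l hl).exists_bound_iteratedDeriv
      (isCompact_Icc (a := -2) (b := 2))
    have hcs := hc.smoothCurve l hl
    -- This is where `M n → ∞` enters: `(C / M n) ^ n ≤ 1` as soon as `M n ≥ C`, whatever constant
    -- `C` the functional has.
    obtain ⟨W, hW⟩ : ∃ W, ∀ n : ℕ, (C / M n) ^ n ≤ W := by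
      have h1 : IsBoundedUnder (· ≤ ·) atTop fun n : ℕ => (C / M n) ^ n := by
        refine isBoundedUnder_of_eventually_le (a := 1) ?_
        filter_upwards [hM.eventually_ge_atTop C] with n hn
        exact pow_le_one₀ (div_nonneg hC (hMpos n).le) ((div_le_one (hMpos n)).2 hn)
      obtain ⟨W, hW⟩ := h1.bddAbove_range
      exact ⟨W, fun n => hW ⟨n, rfl⟩⟩
    refine isBounded_iff_forall_norm_le.2 ⟨K * W, ?_⟩
    rintro _ ⟨e, (⟨a, n, ha, rfl⟩ | ⟨a, s, m, ha, hs, rfl⟩), rfl⟩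
    · have h1 := hb a (abs_le.1 (ha.trans (by norm_num))) n
      have hMn := pow_pos (hMpos n) n
      simp only [co, map_smul, smul_eq_mul, hD n l hl]
      rw [Real.norm_eq_abs, abs_mul, abs_mul, abs_inv, abs_of_pos hMn, abs_of_pos (by positivity)]
      calc (M n ^ n)⁻¹ * (1 / (n.factorial : ℝ) * |iteratedDeriv n (fun s => l (c s)) a|)
          ≤ (M n ^ n)⁻¹ * (1 / (n.factorial : ℝ) * (K * C ^ n * n.factorial)) := by gcongr
        _ = K * (C / M n) ^ n := by rw [div_pow]; field_simp
        _ ≤ K * W := by gcongr; exact hW n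
    · have h1 : l (rem a s m) = l (c (a + s)) - ∑ n ∈ Finset.range (m + 1),
          iteratedDeriv n (fun s => l (c s)) a / n.factorial * (a + s - a) ^ n := by
        simp only [rem, co, map_sub, map_sum, map_smul, smul_eq_mul, hD _ l hl,
          add_sub_cancel_left]
        congr 1
        exact Finset.sum_congr rfl fun n _ => by ring
      have hmem : ∀ t ∈ Set.uIcc a (a + s), t ∈ Set.Icc (-2 : ℝ) 2 := by
        intro t ht
        have h2 := Set.abs_sub_left_of_mem_uIcc ht
        rw [add_sub_cancel_left] at h2
        have h3 := abs_add_le (t - a) a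
        rw [sub_add_cancel] at h3
        exact abs_le.1 (by linarith)
      have h2 := abs_sub_taylor_le (g := fun s => l (c s)) (n := m) (x₀ := a) (x := a + s)
        (fun t _ => hcs.contDiffAt.of_le (by exact_mod_cast le_top))
        (C := K * C ^ (m + 1) * (m + 1).factorial) fun t ht => hb t (hmem t ht) (m + 1)
      rw [← h1, add_sub_cancel_left] at h2
      rw [map_smul, smul_eq_mul, Real.norm_eq_abs, abs_mul, abs_inv,
        abs_of_nonneg (pow_nonneg (mul_nonneg (hMpos _).le (abs_nonneg s)) _)]
      have hKW : 0 ≤ K * W := mul_nonneg hK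
        ((pow_nonneg (div_nonneg hC (hMpos 0).le) 0).trans (hW 0))
      refine inv_mul_le_of_le_mul₀ (by have := hMpos (m + 1); positivity) hKW (h2.trans ?_)
      have h3 : K * C ^ (m + 1) * (m + 1).factorial * |s| ^ (m + 1) / (m + 1).factorial =
          (M (m + 1) * |s|) ^ (m + 1) * (K * (C / M (m + 1)) ^ (m + 1)) := by
        have := (hMpos (m + 1)).ne'
        rw [div_pow, mul_pow]
        field_simp
      rw [h3]
      have := hMpos (m + 1)
      gcongr
      exact hW (m + 1)
  obtain ⟨X, _, _, _, i, hi, hiB, hicont⟩ := hP.exists_banach hB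
  have hlift : ∀ (e : E) (ρ : ℝ), 0 < ρ → ρ⁻¹ • e ∈ B → ∃ x : X, ‖x‖ ≤ ρ ∧ i x = e := by
    intro e ρ hρ he
    obtain ⟨x, hx1, hx⟩ := hiB _ he
    refine ⟨ρ • x, ?_, by rw [map_smul, hx, smul_inv_smul₀ hρ.ne']⟩
    rw [norm_smul, Real.norm_of_nonneg hρ.le]
    exact mul_le_of_le_one_right hρ.le hx1
  have hlco : ∀ a n, |a| ≤ 1 → ∃ x : X, ‖x‖ ≤ M n ^ n ∧ i x = co a n := fun a n ha =>
    hlift _ _ (pow_pos (hMpos n) n) (Or.inl ⟨a, n, ha, rfl⟩)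
  have hco0 : ∀ a, co a 0 = c a := fun a => by simp [co, hD0]
  have hlrem : ∀ a s l, |a| ≤ 1 → |s| ≤ 1 → ∃ x : X, ‖x‖ ≤ (M (l + 1) * |s|) ^ (l + 1) ∧
      i x = rem a s l := by
    intro a s l ha hs
    rcases eq_or_ne s 0 with rfl | hs0
    · refine ⟨0, by simp, ?_⟩
      simp only [rem, map_zero, add_zero]
      rw [Finset.sum_range_succ']
      simp [hco0]
    · have := mul_pos (hMpos (l + 1)) (abs_pos.2 hs0)
      exact hlift _ _ (pow_pos this _) (Or.inr ⟨a, s, l, ha, hs, rfl⟩)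
  have hstep : ∀ a s, |a| ≤ 1 → |s| ≤ 1 → ∃ x : X, i x = c (a + s) - c a := by
    intro a s ha hs
    obtain ⟨x, -, hx⟩ := hlrem a s 0 ha hs
    refine ⟨x, ?_⟩
    rw [hx]
    simp [rem, hco0]
  -- Remainders are lifted only for steps of length at most `1`, so `t` is reached in two half
  -- steps.
  have hγ : ∀ t, |t| ≤ 2 → ∃ x : X, i x = c t - c 0 := by
    intro t ht
    have h2 : |t / 2| ≤ 1 := by rw [abs_div, abs_two]; linarith
    obtain ⟨x, hx⟩ := hstep 0 (t / 2) (by simp) h2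
    obtain ⟨y, hy⟩ := hstep (t / 2) (t / 2) h2 h2
    refine ⟨x + y, ?_⟩
    rw [map_add, hx, hy, zero_add, add_halves]
    abel
  let γ : ℝ → X := fun t => Function.invFun i (c t - c 0)
  have hγi : ∀ t, |t| ≤ 2 → i (γ t) = c t - c 0 := fun t ht => Function.invFun_eq (hγ t ht)
  -- The coefficient of order `0` is `γ a`, since the lift represents `c - c 0` rather than `c`.
  let d : ℝ → ℕ → X := fun a n => if n = 0 then γ a else Function.invFun i (co a n)
  have hdi : ∀ a, |a| ≤ 1 → ∀ n, i (d a (n + 1)) = co a (n + 1) := fun a ha n => by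
    obtain ⟨x, -, hx⟩ := hlco a (n + 1) ha
    simp only [d, if_neg (Nat.succ_ne_zero n)]
    exact Function.invFun_eq ⟨x, hx⟩
  refine ⟨X, inferInstance, inferInstance, inferInstance, i, γ, d, hicont, fun t ht => ?_, ?_,
    fun a => rfl, fun a ha n hn => ?_, fun a s ha hs l => ?_⟩
  · rw [hγi t ht, add_sub_cancel]
  · refine hi ?_
    rw [hγi 0 (by simp), sub_self, map_zero]
  · obtain ⟨x, hx1, hx⟩ := hlco a n ha
    obtain ⟨m, rfl⟩ := Nat.exists_eq_succ_of_ne_zero (by omega : n ≠ 0)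
    rwa [hi ((hdi a ha m).trans hx.symm)]
  · obtain ⟨x, hx1, hx⟩ := hlrem a s l ha hs
    have : γ (a + s) - ∑ n ∈ Finset.range (l + 1), s ^ n • d a n = x := by
      refine hi ?_
      rw [hx, map_sub, hγi _ (by linarith [abs_add_le a s])]
      simp only [rem, map_sum, map_smul]
      rw [Finset.sum_range_succ', Finset.sum_range_succ' (fun n => s ^ n • co a n)]
      simp only [hdi a ha, pow_zero, one_smul, hco0]
      have h0 : i (d a 0) = c a - c 0 := hγi a (by linarith)
      rw [h0]
      abel
    rwa [this]

/-- In a Banach space mapping into `E`, a `c^∞`-open set contains a ball around each point. -/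
theorem CInftyOpen.exists_ball_subset {P : DualPair E} {U : Set E} (hU : P.CInftyOpen U)
    {X : Type*} [NormedAddCommGroup X] [NormedSpace ℝ X] [CompleteSpace X] {i : X →ₗ[ℝ] E}
    (hi : ∀ l ∈ P.dual, Continuous fun x => l (i x)) {x₀ : E} (hx₀ : x₀ ∈ U) :
    ∃ δ > 0, ∀ y : X, ‖y‖ < δ → x₀ + i y ∈ U := by
  obtain ⟨ε, hε, H⟩ := exists_smooth_curve_through X
  by_contra hcon
  push Not at hcon
  choose y hy hyU using fun n => hcon (ε n) (hε n)
  -- A smooth curve through points `y n → 0` whose images lie outside `U`: it is in `U` at time `0`,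
  -- hence at the times `(1 / 2) ^ n` for large `n`.
  obtain ⟨γ, hγ, -, hγ0, hγy⟩ := H 1 one_pos y (fun _ => 0)
    (fun n => by rw [one_mul]; exact (hy n).le) fun n => by simpa using (hε n).le
  have hsmooth : P.SmoothCurve fun t => x₀ + i (γ t) := fun l hl => by
    simp only [map_add]
    let L : X →L[ℝ] ℝ := ⟨l.comp i, hi l hl⟩
    exact contDiff_const.add (L.contDiff.comp hγ)
  have h0 : (0 : ℝ) ∈ (fun t => x₀ + i (γ t)) ⁻¹' U := by
    simpa [hγ0] using hx₀
  have hlim : Tendsto (fun n : ℕ => (1 / 2 : ℝ) ^ n) atTop (𝓝 0) :=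
    tendsto_pow_atTop_nhds_zero_of_lt_one (by norm_num) (by norm_num)
  obtain ⟨n, hn⟩ := (hlim.eventually ((hU _ hsmooth).mem_nhds h0)).exists
  have hval : γ ((1 / 2) ^ n) = y n := by simpa using (hγy n).self_of_nhds
  refine hyU n ?_
  have hn' : x₀ + i (γ ((1 / 2) ^ n)) ∈ U := hn
  rwa [hval] at hn'

theorem analyticAt_comp_of_analyticAlongLines {P : DualPair E} {Q : DualPair F}
    (hP : P.IsComplete) {U : Set E} (hU : P.CInftyOpen U) {f : E → F} (hf : P.SmoothOn Q f U)
    {l : Module.Dual ℝ F} (hl : l ∈ Q.dual) (hline : AnalyticAlongLinesOn (fun x => l (f x)) U)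
    {c : ℝ → E} (hc : P.AnalyticCurve c) (hcU : ∀ t, c t ∈ U) :
    AnalyticAt ℝ (fun t => l (f (c t))) 0 := by
  by_contra hna
  have hg : ContDiff ℝ ∞ fun t => l (f (c t)) := hf c hc.smoothCurve hcU l hl
  obtain ⟨L, hL, hbig⟩ := exists_subsequence_of_not_analyticAt hg hna
  -- A left inverse of `L`; the search bound `n` is harmless because `j ≤ L j`. It makes `M`
  -- increase to infinity so slowly that `M (L j) = j + 1`.
  let m : ℕ → ℕ := fun n => Nat.findGreatest (fun j => L j ≤ n) n
  have hm : Monotone m := fun a b hab =>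
    Nat.findGreatest_mono (fun j (hj : L j ≤ a) => hj.trans hab) hab
  have hmL : ∀ j, m (L j) = j := fun j => by
    refine le_antisymm ?_ (Nat.le_findGreatest (hL.id_le j) le_rfl)
    rcases Nat.eq_zero_or_pos (m (L j)) with h | h
    · rw [h]; exact Nat.zero_le _
    · exact hL.le_iff_le.1 (Nat.findGreatest_of_ne_zero (P := fun k => L k ≤ L j) rfl h.ne')
  let M : ℕ → ℝ := fun n => (m n : ℝ) + 1
  have hMmono : Monotone M := fun a b hab => by
    have : (m a : ℝ) ≤ m b := by exact_mod_cast hm hab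
    simpa [M] using this
  have hM1 : ∀ n, 1 ≤ M n := fun n => le_add_of_nonneg_left (Nat.cast_nonneg _)
  have hMtop : Tendsto M atTop atTop := by
    refine tendsto_atTop_add_const_right _ _ (tendsto_natCast_atTop_atTop.comp ?_)
    exact tendsto_atTop_atTop_of_monotone hm fun b => ⟨L b, (hmL b).ge⟩
  obtain ⟨X, _, _, _, i, γ, d, hi, hγ, hγ0, hd0, hd, hrem⟩ := hc.exists_banach hP hM1 hMtop
  obtain ⟨δ, hδ, hball⟩ := hU.exists_ball_subset hi (hcU 0)
  have hh : AnalyticAt ℝ (fun y : X => l (f (c 0 + i y))) 0 := by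
    refine analyticAt_of_smooth_of_analyticAlongLines hδ (fun γ' hγ' hγδ => ?_) fun y v t ht => ?_
    · refine hf (fun t => c 0 + i (γ' t)) (fun l' hl' => ?_) (fun t => hball _ (hγδ t)) l hl
      simp only [map_add]
      let L' : X →L[ℝ] ℝ := ⟨l'.comp i, hi l' hl'⟩
      exact contDiff_const.add (L'.contDiff.comp hγ')
    · have h1 := hline (c 0 + i y) (i v) t (by
        have := hball _ ht
        rwa [map_add, map_smul, ← add_assoc] at this)
      simpa only [map_add, map_smul, ← add_assoc] using h1
  obtain ⟨η, hη, K, C, hK, hC, hest⟩ := exists_bound_iteratedDeriv_comp hh hMmono hM1 hγ0 hd0 hd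
    hrem hg fun t ht => by rw [hγ t ht]
  obtain ⟨j, hj⟩ := exists_nat_gt (max (max K C) (1 / η))
  have hj1 : (0 : ℝ) < (j : ℝ) + 1 := by positivity
  have hjK : K ≤ (j : ℝ) + 1 := by
    linarith [(le_max_left K C).trans (le_max_left (max K C) (1 / η))]
  have hjC : C ≤ (j : ℝ) + 1 := by
    linarith [(le_max_right K C).trans (le_max_left (max K C) (1 / η))]
  have hjη : 1 / ((j : ℝ) + 1) ≤ η := by
    rw [div_le_iff₀ hj1]
    have h1 : 1 / η < j := (le_max_right _ _).trans_lt hj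
    rw [div_lt_iff₀ hη] at h1
    nlinarith
  obtain ⟨a, ha, hlt⟩ := hbig j
  refine absurd (hest a (ha.trans_le hjη) (L j)) (not_le.2 (lt_of_le_of_lt ?_ hlt))
  -- Of the factors `j + 1` in the lower bound, the single one beats `K`; in the square, one beats
  -- `C` and the other equals `M (L j)`.
  have hMj : M (L j) = (j : ℝ) + 1 := by simp only [M, hmL]
  rw [hMj, sq]
  gcongr

/-! ### Restriction to affine lines, and the theorem. -/

theorem analyticAlongLinesOn_of_realAnalyticOn {P : DualPair E} {Q : DualPair F} {U : Set E}
    (hU : P.CInftyOpen U) {f : E → F} (hf : P.RealAnalyticOn Q f U) {l : Module.Dual ℝ F}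
    (hl : l ∈ Q.dual) : AnalyticAlongLinesOn (fun x => l (f x)) U := by
  intro x v t₀ ht₀
  have hline : P.SmoothCurve fun t : ℝ => x + t • v := fun l' _ => by
    simp only [map_add, map_smul, smul_eq_mul]
    fun_prop
  obtain ⟨δ, hδ, hball⟩ := Metric.isOpen_iff.1 (hU _ hline) t₀ ht₀
  -- Analytic curves must be defined on all of `ℝ` with values in `U`, but the line may leave `U`.
  -- The map `σ s = t₀ + δ tanh (s / 2)` keeps to the part near `t₀`, and its analytic inverse `τ`
  -- recovers the line.
  let σ : ℝ → ℝ := fun s => t₀ + δ * ((Real.exp s - 1) / (Real.exp s + 1))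
  have hσ : ∀ s, AnalyticAt ℝ σ s := fun s => by
    refine analyticAt_const.add (analyticAt_const.mul (AnalyticAt.div ?_ ?_ (by positivity)))
    · exact analyticAt_rexp.sub analyticAt_const
    · exact analyticAt_rexp.add analyticAt_const
  have hσball : ∀ s, σ s ∈ Metric.ball t₀ δ := fun s => by
    have h1 := Real.exp_pos s
    rw [Metric.mem_ball, Real.dist_eq, add_sub_cancel_left, abs_mul, abs_of_pos hδ]
    refine mul_lt_of_lt_one_right hδ ?_
    rw [abs_div, abs_of_pos (by positivity : 0 < Real.exp s + 1), div_lt_one (by positivity),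
      abs_lt]
    constructor <;> linarith
  have hcurve := hf.2 (fun s => x + σ s • v) (fun l' _ s _ => by
    simp only [map_add, map_smul, smul_eq_mul]
    exact analyticAt_const.add ((hσ s).mul analyticAt_const)) (fun s => hball (hσball s)) l hl
  let τ : ℝ → ℝ := fun t => Real.log ((1 + (t - t₀) / δ) / (1 - (t - t₀) / δ))
  have hτ : AnalyticAt ℝ τ t₀ := by
    have hu : AnalyticAt ℝ (fun t : ℝ => (t - t₀) / δ) t₀ :=
      (analyticAt_id.sub analyticAt_const).div analyticAt_const hδ.ne'
    refine AnalyticAt.log ((analyticAt_const.add hu).div (analyticAt_const.sub hu) ?_) ?_ <;> simp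
  refine (AnalyticAt.comp_of_eq (hcurve (τ t₀) trivial) hτ rfl).congr ?_
  filter_upwards [Metric.ball_mem_nhds t₀ hδ] with t ht
  have hστ : σ (τ t) = t := by
    rw [Metric.mem_ball, Real.dist_eq] at ht
    have hlt : |(t - t₀) / δ| < 1 := by rwa [abs_div, abs_of_pos hδ, div_lt_one hδ]
    obtain ⟨h1, h2⟩ := abs_lt.1 hlt
    have h3 : 0 < 1 - (t - t₀) / δ := by linarith
    have h4 : 0 < 1 + (t - t₀) / δ := by linarith
    simp only [σ, τ]
    rw [Real.exp_log (div_pos h4 h3)]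
    have h5 : ((1 + (t - t₀) / δ) / (1 - (t - t₀) / δ) - 1) /
        ((1 + (t - t₀) / δ) / (1 - (t - t₀) / δ) + 1) = (t - t₀) / δ := by
      rw [div_sub_one h3.ne', div_add_one h3.ne', div_div_div_cancel_right₀ h3.ne']
      ring
    rw [h5, mul_div_cancel₀ _ hδ.ne', add_sub_cancel]
  simp only [Function.comp_apply, hστ]

end DualPair

theorem mainTheorem2 {E F : Type*} [AddCommGroup E] [Module ℝ E] [AddCommGroup F] [Module ℝ F]
    (P : DualPair E) (Q : DualPair F) (hP : P.IsComplete) (hQ : Q.IsComplete)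
    (U : Set E) (hU : P.CInftyOpen U) (f : E → F) :
    P.RealAnalyticOn Q f U ↔
      P.SmoothOn Q f U ∧
        ∀ l ∈ Q.dual, DualPair.AnalyticAlongLinesOn (fun x => l (f x)) U := by
  refine ⟨fun h => ⟨h.1, fun l hl => DualPair.analyticAlongLinesOn_of_realAnalyticOn hU h hl⟩,
    fun h => ⟨h.1, fun c hc hcU l hl t₀ _ => ?_⟩⟩
  -- Translating the parameter reduces analyticity at `t₀` to analyticity at `0`.
  have hc' : P.AnalyticCurve fun t => c (t₀ + t) := fun l' hl' t _ =>
    AnalyticAt.comp_of_eq (g := fun t => l' (c t)) (hc l' hl' (t₀ + t) trivial)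
      (analyticAt_const.add analyticAt_id) rfl
  have h0 := DualPair.analyticAt_comp_of_analyticAlongLines hP hU h.1 hl (h.2 l hl) hc'
    fun t => hcU (t₀ + t)
  have h1 : AnalyticAt ℝ (fun t : ℝ => t - t₀) t₀ := analyticAt_id.sub analyticAt_const
  have h2 := AnalyticAt.comp_of_eq h0 h1 (sub_self t₀)
  simpa only [Function.comp_def, add_sub_cancel] using h2
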